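/- Let $d\ge 2$ and $0<s<\frac d2$; all functions below are real-valued on $\mathbb R^d$. Let $$\mathring H^s(\mathbb R^d)=\Big\{u\in L^{\frac{2d}{d-2s}}(\mathbb R^d):\ \widehat u \text{ is a function and } \|u\|_{\mathring H^s}^2:=\int_{\mathbb R^d}|\xi|^{2s}|\widehat u(\xi)|^2\,d\xi<\infty\Big\},$$ where $\widehat u$ is the Fourier transform of $u$ as a tempered distribution, and let $\mathring H^{-s}(\mathbb R^d)$ be the dual space of $\mathring H^s(\mathbb R^d)$, with duality pairing $\langle\cdot,\cdot\rangle$. For $q\in[1,\infty]$, $T\in\mathring H^{-s}(\mathbb R^d)\cap L^q_{loc}(\mathbb R^d)$ means that $T$ is a function in $L^q(K)$ for every compact set $K\subset\mathbb R^d$, together with a continuous linear functional on $\mathring H^s(\mathbb R^d)$, also denoted by $T$, such that $\langle T,\varphi\rangle=\int_{\mathbb R^d}T(x)\varphi(x)\,dx$ for all $\varphi\in C_c^\infty(\mathbb R^d)$. **Theorem.** Let $T\in \mathring H^{-s}(\mathbb R^d)\cap L^q_{loc}(\mathbb R^d)$ with $\frac{2d}{d+2s}\le q\le\infty$, and let $u\in\mathring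 H^s(\mathbb R^d)$ be such that $T(x)u(x)\ge -|f(x)|$ for almost every $x\in\mathbb R^d$, for some $f\in L^1(\mathbb R^d)$. Then $Tu\in L^1(\mathbb R^d)$ and $$\langle T,u\rangle=\int_{\mathbb R^d}T(x)u(x)\,dx .$$ -/

import Mathlib

open MeasureTheory
open scoped ENNReal ContDiff SchwartzMap FourierTransform

/-- The Euclidean space `ℝᵈ`. -/
abbrev Eucl (d : ℕ) : Type := EuclideanSpace ℝ (Fin d)

/-- The critical Sobolev exponent `2d / (d - 2s)`. -/
noncomputable def sobolevExponent (d : ℕ) (s : ℝ) : ℝ≥0∞ :=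
  ENNReal.ofReal (2 * d / (d - 2 * s))

/-- The function `g` is the Fourier transform of the (real-valued) function `u`, in the sense of
tempered distributions: `g` defines a tempered distribution, and `⟨u, 𝓕 φ⟩ = ⟨g, φ⟩` for every
Schwartz function `φ`. (Fourier transforms are normalised as in Mathlib,
`𝓕 φ ξ = ∫ exp (-2πi x·ξ) φ x dx`.) -/
structure IsFourierTransformOf {d : ℕ} (u : Eucl d → ℝ) (g : Eucl d → ℂ) : Prop where
  aestronglyMeasurable : AEStronglyMeasurable g volume
  integrable_mul : ∀ φ : 𝓢(Eucl d, ℂ), Integrable (fun ξ => g ξ * φ ξ) volume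
  integral_eq : ∀ φ : 𝓢(Eucl d, ℂ), ∫ x, (u x : ℂ) * (𝓕 φ) x = ∫ ξ, g ξ * φ ξ

namespace IsFourierTransformOf

variable {d : ℕ} {u v : Eucl d → ℝ} {g h : Eucl d → ℂ}

theorem locallyIntegrable (hg : IsFourierTransformOf u g) : LocallyIntegrable g volume := by
  rw [locallyIntegrable_iff]
  intro K hK
  obtain ⟨r, hr⟩ := hK.isBounded.subset_closedBall (0 : Eucl d)
  let b : ContDiffBump (0 : Eucl d) := ⟨max r 1, max r 1 + 1, by positivity, by linarith⟩
  have hbc : HasCompactSupport (fun x => ((b x : ℝ) : ℂ)) :=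
    b.hasCompactSupport.comp_left (g := fun t : ℝ => (t : ℂ)) (by simp)
  have hbs : ContDiff ℝ ∞ (fun x => ((b x : ℝ) : ℂ)) :=
    Complex.ofRealCLM.contDiff.comp b.contDiff
  have key := (hg.integrable_mul (hbc.toSchwartzMap hbs)).integrableOn (s := K)
  refine key.congr_fun (fun x hx => ?_) hK.measurableSet
  have : b x = 1 := b.one_of_mem_closedBall
    (Metric.closedBall_subset_closedBall (le_max_left _ _) (hr hx))
  simp [this]

theorem ae_eq (hg : IsFourierTransformOf u g) (hh : IsFourierTransformOf v h) (huv : u =ᵐ[volume] v) :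
    g =ᵐ[volume] h := by
  refine ae_eq_of_integral_contDiff_smul_eq hg.locallyIntegrable hh.locallyIntegrable ?_
  intro φ hφ hc
  have hbc : HasCompactSupport (fun x => ((φ x : ℝ) : ℂ)) :=
    hc.comp_left (g := fun t : ℝ => (t : ℂ)) (by simp)
  have hbs : ContDiff ℝ ∞ (fun x => ((φ x : ℝ) : ℂ)) := Complex.ofRealCLM.contDiff.comp hφ
  have e1 := hg.integral_eq (hbc.toSchwartzMap hbs)
  have e2 := hh.integral_eq (hbc.toSchwartzMap hbs)
  have e3 : ∫ x, (u x : ℂ) * (𝓕 (hbc.toSchwartzMap hbs)) x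
      = ∫ x, (v x : ℂ) * (𝓕 (hbc.toSchwartzMap hbs)) x :=
    integral_congr_ae (huv.mono fun x hx => by simp [hx])
  rw [e1, e2] at e3
  simpa [mul_comm] using e3

theorem congr_ae (hg : IsFourierTransformOf u g) (huv : u =ᵐ[volume] v) :
    IsFourierTransformOf v g where
  aestronglyMeasurable := hg.aestronglyMeasurable
  integrable_mul := hg.integrable_mul
  integral_eq φ := by
    rw [← hg.integral_eq φ]
    exact integral_congr_ae (huv.mono fun x hx => by simp [hx])

theorem integrable_mul_schwartz {p : ℝ≥0∞} (hp : 1 ≤ p) (hu : MemLp u p volume)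
    (φ : 𝓢(Eucl d, ℂ)) : Integrable (fun x => (u x : ℂ) * φ x) volume := by
  have : p.HolderConjugate p.conjExponent := ENNReal.HolderConjugate.conjExponent hp
  exact hu.ofReal.integrable_mul (φ.memLp p.conjExponent volume)

theorem add {p : ℝ≥0∞} (hp : 1 ≤ p) (hu : MemLp u p volume) (hv : MemLp v p volume)
    (hg : IsFourierTransformOf u g) (hh : IsFourierTransformOf v h) :
    IsFourierTransformOf (u + v) (g + h) where
  aestronglyMeasurable := hg.aestronglyMeasurable.add hh.aestronglyMeasurable
  integrable_mul φ := by
    simpa [add_mul] using! (hg.integrable_mul φ).add (hh.integrable_mul φ)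
  integral_eq φ := by
    simp only [Pi.add_apply, Complex.ofReal_add, add_mul]
    rw [integral_add (integrable_mul_schwartz hp hu _) (integrable_mul_schwartz hp hv _),
      integral_add (hg.integrable_mul φ) (hh.integrable_mul φ), hg.integral_eq, hh.integral_eq]

theorem smul (c : ℝ) (hg : IsFourierTransformOf u g) :
    IsFourierTransformOf (c • u) (c • g) where
  aestronglyMeasurable := hg.aestronglyMeasurable.const_smul c
  integrable_mul φ := by
    simpa [mul_assoc] using! (hg.integrable_mul φ).const_mul (c : ℂ)
  integral_eq φ := by
    simp only [Pi.smul_apply, smul_eq_mul, Complex.ofReal_mul, Complex.real_smul, mul_assoc]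
    rw [integral_const_mul, integral_const_mul, hg.integral_eq]

theorem zero : IsFourierTransformOf (0 : Eucl d → ℝ) 0 where
  aestronglyMeasurable := aestronglyMeasurable_zero
  integrable_mul φ := by simp
  integral_eq φ := by simp

theorem ae_eq_zero {p : ℝ≥0∞} (hp : 1 ≤ p) (hu : MemLp u p volume)
    (hg : IsFourierTransformOf u g) (h0 : g =ᵐ[volume] 0) : u =ᵐ[volume] 0 := by
  refine ae_eq_zero_of_integral_contDiff_smul_eq_zero (hu.locallyIntegrable hp) ?_
  intro φ hφ hc
  have hbc : HasCompactSupport (fun x => ((φ x : ℝ) : ℂ)) :=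
    hc.comp_left (g := fun t : ℝ => (t : ℂ)) (by simp)
  have hbs : ContDiff ℝ ∞ (fun x => ((φ x : ℝ) : ℂ)) := Complex.ofRealCLM.contDiff.comp hφ
  have e1 := hg.integral_eq (𝓕⁻ (hbc.toSchwartzMap hbs))
  have e2 : ∫ ξ, g ξ * (𝓕⁻ (hbc.toSchwartzMap hbs)) ξ = 0 := by
    rw [← integral_zero (Eucl d) ℂ]
    exact integral_congr_ae (h0.mono fun x hx => by simp [hx])
  rw [e2, FourierTransform.fourier_fourierInv_eq] at e1
  have e3 : ∫ x, (u x : ℂ) * (hbc.toSchwartzMap hbs) x = ((∫ x, φ x • u x : ℝ) : ℂ) := by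
    rw [← integral_complex_ofReal]
    exact integral_congr_ae (Filter.Eventually.of_forall fun x => by simp [mul_comm])
  rw [e3] at e1
  exact_mod_cast e1

end IsFourierTransformOf

theorem one_le_sobolevExponent (d : ℕ) (s : ℝ) (hs : 0 < s ∧ s < (d : ℝ) / 2) :
    1 ≤ sobolevExponent d s := by
  obtain ⟨h0, h1⟩ := hs
  rw [sobolevExponent, ENNReal.one_le_ofReal, le_div_iff₀ (by linarith)]
  linarith

theorem norm_weight_sq {d : ℕ} (s : ℝ) (ξ : Eucl d) (z : ℂ) :
    ‖(‖ξ‖ ^ s : ℝ) • z‖ ^ 2 = ‖ξ‖ ^ (2 * s) * ‖z‖ ^ 2 := by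
  rw [norm_smul, mul_pow, Real.norm_of_nonneg (by positivity), ← Real.rpow_natCast,
    ← Real.rpow_mul (norm_nonneg ξ)]
  congr 2
  push_cast
  ring

section HomSobolev

variable (d : ℕ) (s : ℝ) [hs : Fact (0 < s ∧ s < (d : ℝ) / 2)]

/-- The real-valued functions `u ∈ L^{2d/(d-2s)}(ℝᵈ)` whose Fourier transform `û` is a function
with `∫ |ξ|^{2s} |û(ξ)|² dξ < ∞`. -/
def homSobolevSubmodule : Submodule ℝ (Lp ℝ (sobolevExponent d s) (volume : Measure (Eucl d))) where
  carrier := {u | ∃ g : Eucl d → ℂ, IsFourierTransformOf u g ∧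
    Integrable (fun ξ => ‖ξ‖ ^ (2 * s) * ‖g ξ‖ ^ 2) volume}
  add_mem' := by
    rintro u v ⟨g, hg, hgi⟩ ⟨h, hh, hhi⟩
    refine ⟨g + h, ((hg.add (one_le_sobolevExponent d s hs.out) (Lp.memLp u) (Lp.memLp v)
      hh)).congr_ae (Lp.coeFn_add u v).symm, ?_⟩
    have hm : Measurable fun ξ : Eucl d => ‖ξ‖ ^ (2 * s) := by fun_prop
    refine ((hgi.add hhi).const_mul 2).mono' (hm.aestronglyMeasurable.mul
      ((hg.aestronglyMeasurable.add hh.aestronglyMeasurable).norm.pow 2)) ?_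
    refine Filter.Eventually.of_forall fun ξ => ?_
    have h1 : 0 ≤ ‖ξ‖ ^ (2 * s) := by positivity
    have h2 : ‖g ξ + h ξ‖ ^ 2 ≤ 2 * (‖g ξ‖ ^ 2 + ‖h ξ‖ ^ 2) := by
      nlinarith [norm_add_le (g ξ) (h ξ), sq_nonneg (‖g ξ‖ - ‖h ξ‖), norm_nonneg (g ξ + h ξ),
        norm_nonneg (g ξ), norm_nonneg (h ξ)]
    simp only [Pi.add_apply]
    rw [Real.norm_of_nonneg (by positivity)]
    nlinarith [mul_le_mul_of_nonneg_left h2 h1]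
  zero_mem' := by
    refine ⟨0, IsFourierTransformOf.zero.congr_ae (Lp.coeFn_zero ℝ _ volume).symm, ?_⟩
    simp
  smul_mem' := by
    rintro c u ⟨g, hg, hgi⟩
    refine ⟨c • g, (hg.smul c).congr_ae (Lp.coeFn_smul c u).symm, ?_⟩
    refine (hgi.const_mul (c ^ 2)).congr (Filter.Eventually.of_forall fun ξ => ?_)
    simp only [Pi.smul_apply, norm_smul, mul_pow, Real.norm_eq_abs, sq_abs]
    ring

/-- The homogeneous fractional Sobolev space `H̊ˢ(ℝᵈ)`, for `0 < s < d / 2`. It is a type of its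
own because it carries the norm `(∫ |ξ|^{2s} |û(ξ)|² dξ)^{1/2}` and not the Lebesgue norm. -/
def HomSobolev : Type := homSobolevSubmodule d s

namespace HomSobolev

noncomputable instance : AddCommGroup (HomSobolev d s) :=
  inferInstanceAs (AddCommGroup (homSobolevSubmodule d s))

noncomputable instance : Module ℝ (HomSobolev d s) :=
  inferInstanceAs (Module ℝ (homSobolevSubmodule d s))

variable {d s}

/-- The underlying element of `L^{2d/(d-2s)}(ℝᵈ)`. -/
def toLp (u : HomSobolev d s) : Lp ℝ (sobolevExponent d s) (volume : Measure (Eucl d)) := u.1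

noncomputable instance : CoeFun (HomSobolev d s) fun _ => Eucl d → ℝ :=
  ⟨fun u => (u.toLp : Eucl d → ℝ)⟩

/-- The Fourier transform `û` of `u ∈ H̊ˢ(ℝᵈ)`, a function unique up to null sets. -/
noncomputable def fourier (u : HomSobolev d s) : Eucl d → ℂ := u.2.choose

noncomputable instance : Norm (HomSobolev d s) :=
  ⟨fun u => Real.sqrt (∫ ξ, ‖ξ‖ ^ (2 * s) * ‖u.fourier ξ‖ ^ 2)⟩

theorem norm_def (u : HomSobolev d s) :
    ‖u‖ = Real.sqrt (∫ ξ, ‖ξ‖ ^ (2 * s) * ‖u.fourier ξ‖ ^ 2) := rfl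

theorem isFourierTransformOf_fourier (u : HomSobolev d s) : IsFourierTransformOf u u.fourier :=
  u.2.choose_spec.1

theorem integrable_fourier (u : HomSobolev d s) :
    Integrable (fun ξ => ‖ξ‖ ^ (2 * s) * ‖u.fourier ξ‖ ^ 2) volume :=
  u.2.choose_spec.2

theorem memLp (u : HomSobolev d s) : MemLp u (sobolevExponent d s) volume := Lp.memLp _

theorem coe_add (u v : HomSobolev d s) : ⇑(u + v) =ᵐ[volume] u + v := Lp.coeFn_add u.toLp v.toLp

theorem coe_smul (c : ℝ) (u : HomSobolev d s) : ⇑(c • u) =ᵐ[volume] c • u :=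
  Lp.coeFn_smul c u.toLp

theorem fourier_add (u v : HomSobolev d s) :
    (u + v).fourier =ᵐ[volume] u.fourier + v.fourier :=
  (u + v).isFourierTransformOf_fourier.ae_eq
    (u.isFourierTransformOf_fourier.add (one_le_sobolevExponent d s hs.out) u.memLp v.memLp
      v.isFourierTransformOf_fourier) (coe_add u v)

theorem fourier_smul (c : ℝ) (u : HomSobolev d s) :
    (c • u).fourier =ᵐ[volume] c • u.fourier :=
  (c • u).isFourierTransformOf_fourier.ae_eq (u.isFourierTransformOf_fourier.smul c) (coe_smul c u)

theorem memLp_weight (u : HomSobolev d s) :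
    MemLp (fun ξ => (‖ξ‖ ^ s : ℝ) • u.fourier ξ) 2 volume := by
  have hm : Measurable fun ξ : Eucl d => ‖ξ‖ ^ s := by fun_prop
  refine (memLp_two_iff_integrable_sq_norm
    (hm.aestronglyMeasurable.smul u.isFourierTransformOf_fourier.aestronglyMeasurable)).2 ?_
  simpa only [Pi.smul_apply', norm_weight_sq] using u.integrable_fourier

theorem norm_eq_toLp (u : HomSobolev d s) : ‖u‖ = ‖u.memLp_weight.toLp‖ := by
  rw [norm_def, Lp.norm_toLp, u.memLp_weight.eLpNorm_eq_integral_rpow_norm (by simp) (by simp),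
    ENNReal.toReal_ofReal (by positivity), Real.sqrt_eq_rpow]
  simp only [ENNReal.toReal_ofNat, Real.rpow_ofNat, norm_weight_sq, one_div]

theorem normedSpaceCore : NormedSpace.Core ℝ (HomSobolev d s) where
  norm_nonneg u := Real.sqrt_nonneg _
  norm_smul c u := by
    have h : (c • u).memLp_weight.toLp = c • u.memLp_weight.toLp := by
      rw [← MemLp.toLp_const_smul]
      refine (MemLp.toLp_eq_toLp_iff _ _).2 ((fourier_smul c u).mono fun ξ hξ => ?_)
      simp only [hξ, Pi.smul_apply]
      rw [smul_comm]
    rw [norm_eq_toLp, norm_eq_toLp, h, norm_smul]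
  norm_triangle u v := by
    have h : (u + v).memLp_weight.toLp = u.memLp_weight.toLp + v.memLp_weight.toLp := by
      rw [← MemLp.toLp_add]
      refine (MemLp.toLp_eq_toLp_iff _ _).2 ((fourier_add u v).mono fun ξ hξ => ?_)
      simp only [hξ, Pi.add_apply, smul_add]
    rw [norm_eq_toLp, norm_eq_toLp, norm_eq_toLp, h]
    exact norm_add_le _ _
  norm_eq_zero_iff u := by
    constructor
    · intro h
      rw [norm_eq_toLp, norm_eq_zero, Lp.eq_zero_iff_ae_eq_zero] at h
      replace h := u.memLp_weight.coeFn_toLp.symm.trans h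
      have hd : Nonempty (Fin d) := by
        refine ⟨⟨0, Nat.pos_of_ne_zero ?_⟩⟩
        rintro rfl
        have := hs.out
        norm_num at this
        linarith
      have hg : u.fourier =ᵐ[volume] 0 := by
        filter_upwards [h, compl_mem_ae_iff.2 (measure_singleton (0 : Eucl d))] with ξ hξ h0
        have : ‖ξ‖ ^ s ≠ 0 := (Real.rpow_pos_of_pos (norm_pos_iff.2 h0) s).ne'
        simpa [this] using hξ
      have hu := u.isFourierTransformOf_fourier.ae_eq_zero
        (one_le_sobolevExponent d s hs.out) u.memLp hg
      exact Subtype.ext ((Lp.eq_zero_iff_ae_eq_zero).2 hu)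
    · rintro rfl
      have h := fourier_smul (0 : ℝ) (0 : HomSobolev d s)
      rw [zero_smul, zero_smul] at h
      rw [norm_eq_toLp, norm_eq_zero, Lp.eq_zero_iff_ae_eq_zero]
      refine (MemLp.coeFn_toLp _).trans (h.mono fun ξ hξ => by simp [hξ])

noncomputable instance : NormedAddCommGroup (HomSobolev d s) :=
  NormedAddCommGroup.ofCore normedSpaceCore

noncomputable instance : NormedSpace ℝ (HomSobolev d s) :=
  NormedSpace.ofCore normedSpaceCore

/-- A test function `φ ∈ C_c^∞(ℝᵈ)`, seen as an element of `H̊ˢ(ℝᵈ)`. -/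
noncomputable def ofTestFunction (φ : Eucl d → ℝ) (hφ : ContDiff ℝ ∞ φ)
    (hc : HasCompactSupport φ) : HomSobolev d s :=
  ⟨((hc.toSchwartzMap hφ).memLp (sobolevExponent d s) volume).toLp, by
    have hbc : HasCompactSupport (fun x => ((φ x : ℝ) : ℂ)) :=
      hc.comp_left (g := fun t : ℝ => (t : ℂ)) (by simp)
    have hbs : ContDiff ℝ ∞ (fun x => ((φ x : ℝ) : ℂ)) := Complex.ofRealCLM.contDiff.comp hφ
    let ψ : 𝓢(Eucl d, ℂ) := 𝓕 (hbc.toSchwartzMap hbs)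
    refine ⟨ψ, IsFourierTransformOf.congr_ae (u := φ) ⟨ψ.continuous.aestronglyMeasurable, ?_, ?_⟩
      (MemLp.coeFn_toLp _).symm, ?_⟩
    · intro f
      exact (ψ.memLp 2 volume).integrable_mul (f.memLp 2 volume)
    · intro f
      have := SchwartzMap.integral_fourier_mul_eq (hbc.toSchwartzMap hbs) f
      simpa using this.symm
    · have hm : Measurable fun ξ : Eucl d => ‖ξ‖ ^ (2 * s) := by fun_prop
      obtain ⟨k, hk⟩ := exists_nat_ge (2 * s)
      obtain ⟨C, hC⟩ : ∃ C, ∀ ξ, ‖ψ ξ‖ ≤ C :=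
        ⟨_, fun ξ => SchwartzMap.norm_le_seminorm ℝ ψ ξ⟩
      refine (((ψ.integrable.norm).add (ψ.integrable_pow_mul volume k)).const_mul C).mono'
        (hm.aestronglyMeasurable.mul (ψ.continuous.aestronglyMeasurable.norm.pow 2)) ?_
      refine Filter.Eventually.of_forall fun ξ => ?_
      have h1 : ‖ξ‖ ^ (2 * s) ≤ 1 + ‖ξ‖ ^ k := by
        rcases le_total ‖ξ‖ 1 with h | h
        · have := Real.rpow_le_one (norm_nonneg ξ) h (z := 2 * s) (by linarith [hs.out.1])
          have : 0 ≤ ‖ξ‖ ^ k := by positivity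
          linarith
        · have := Real.rpow_le_rpow_of_exponent_le h hk
          rw [Real.rpow_natCast] at this
          linarith
      have h2 : 0 ≤ ‖ξ‖ ^ (2 * s) := by positivity
      have h3 := hC ξ
      have h4 := norm_nonneg (ψ ξ)
      rw [Real.norm_of_nonneg (by positivity)]
      simp only [Pi.add_apply]
      calc ‖ξ‖ ^ (2 * s) * ‖ψ ξ‖ ^ 2 ≤ (1 + ‖ξ‖ ^ k) * (C * ‖ψ ξ‖) := by
            gcongr
            nlinarith
        _ = C * (‖ψ ξ‖ + ‖ξ‖ ^ k * ‖ψ ξ‖) := by ring⟩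

theorem coe_ofTestFunction (φ : Eucl d → ℝ) (hφ : ContDiff ℝ ∞ φ) (hc : HasCompactSupport φ) :
    ⇑(ofTestFunction φ hφ hc : HomSobolev d s) =ᵐ[volume] φ :=
  MemLp.coeFn_toLp ((hc.toSchwartzMap hφ).memLp (sobolevExponent d s) volume)

end HomSobolev

/-- The dual space `H̊⁻ˢ(ℝᵈ)` of the normed space `H̊ˢ(ℝᵈ)`; the duality pairing `⟨Λ, u⟩` is the
evaluation `Λ u`. -/
abbrev HomSobolevDual : Type := StrongDual ℝ (HomSobolev d s)

end HomSobolev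

/-- `T ∈ L^q_loc(ℝᵈ)`: the function `T` is in `L^q(K)` for every compact set `K`. -/
def MemLpLocally {d : ℕ} (T : Eucl d → ℝ) (q : ℝ≥0∞) : Prop :=
  ∀ K : Set (Eucl d), IsCompact K → MemLp T q (volume.restrict K)

/-- The functional `Λ ∈ H̊⁻ˢ(ℝᵈ)` is the regular distribution given by the function `T`:
`⟨Λ, φ⟩ = ∫ T φ` for every test function `φ ∈ C_c^∞(ℝᵈ)`. -/
def HomSobolevDual.IsRegular {d : ℕ} {s : ℝ} [Fact (0 < s ∧ s < (d : ℝ) / 2)]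
    (Λ : HomSobolevDual d s) (T : Eucl d → ℝ) : Prop :=
  ∀ (φ : Eucl d → ℝ) (hφ : ContDiff ℝ ∞ φ) (hc : HasCompactSupport φ),
    Λ (HomSobolev.ofTestFunction φ hφ hc) = ∫ x, T x * φ x

open Filter Topology
open scoped Convolution

theorem enorm_rpow_le_mul_add {F : Type*} [NormedAddCommGroup F] (x y : F) {s : ℝ} (hs : 0 < s) :
    ‖x‖ₑ ^ s ≤ 2 ^ s * (‖y‖ₑ ^ s + ‖x - y‖ₑ ^ s) := by
  have h : ‖x‖ₑ ≤ 2 * max ‖y‖ₑ ‖x - y‖ₑ := by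
    calc ‖x‖ₑ = ‖y + (x - y)‖ₑ := by simp
      _ ≤ ‖y‖ₑ + ‖x - y‖ₑ := enorm_add_le _ _
      _ ≤ _ := by
        rw [two_mul]
        exact add_le_add (le_max_left _ _) (le_max_right _ _)
  calc ‖x‖ₑ ^ s ≤ (2 * max ‖y‖ₑ ‖x - y‖ₑ) ^ s := by gcongr
    _ = 2 ^ s * (max ‖y‖ₑ ‖x - y‖ₑ) ^ s := ENNReal.mul_rpow_of_nonneg _ _ hs.le
    _ ≤ _ := by
      gcongr
      rcases le_total ‖y‖ₑ ‖x - y‖ₑ with h | h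
      · rw [max_eq_right h]; exact le_add_self
      · rw [max_eq_left h]; exact le_self_add

theorem ENNReal.add_sq_le_two_mul (a b : ℝ≥0∞) : (a + b) ^ 2 ≤ 2 * (a ^ 2 + b ^ 2) := by
  have h := ENNReal.rpow_add_le_mul_rpow_add_rpow a b (p := 2) (by norm_num)
  norm_num at h
  exact h

section LIntegral

variable {E : Type*} [NormedAddCommGroup E] [InnerProductSpace ℝ E] [FiniteDimensional ℝ E]
  [MeasurableSpace E] [BorelSpace E]

theorem lintegral_comp_smul_of_pos (f : E → ℝ≥0∞) {R : ℝ} (hR : 0 < R) :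
    ∫⁻ x, f (R • x) = ENNReal.ofReal ((R ^ Module.finrank ℝ E)⁻¹) * ∫⁻ x, f x := by
  have h := lintegral_map_equiv (μ := (volume : Measure E)) f
    (Homeomorph.smul (Units.mk0 R hR.ne')).toMeasurableEquiv
  have h2 : Measure.map (Homeomorph.smul (Units.mk0 R hR.ne')).toMeasurableEquiv
      (volume : Measure E) = ENNReal.ofReal |(R ^ Module.finrank ℝ E)⁻¹| • volume :=
    Measure.map_addHaar_smul volume hR.ne'
  rw [h2, lintegral_smul_measure, abs_of_nonneg (by positivity)] at h
  exact h.symm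

/-- Young's inequality `‖k * f‖_p ≤ ‖k‖_1 ‖f‖_p`. -/
theorem lintegral_convolution_rpow_le {p q : ℝ} (hpq : p.HolderConjugate q) {k f : E → ℝ≥0∞}
    (hk : Measurable k) (hf : AEMeasurable f) :
    ∫⁻ x, (∫⁻ y, k (x - y) * f y) ^ p ≤ (∫⁻ x, k x) ^ p * ∫⁻ x, f x ^ p := by
  wlog hf' : Measurable f generalizing f
  · have h := this hf.measurable_mk.aemeasurable hf.measurable_mk
    have e1 : ∫⁻ x, hf.mk f x ^ p = ∫⁻ x, f x ^ p :=
      lintegral_congr_ae (hf.ae_eq_mk.mono fun x hx => by simp [← hx])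
    have e2 (x : E) : ∫⁻ y, k (x - y) * hf.mk f y = ∫⁻ y, k (x - y) * f y :=
      lintegral_congr_ae (hf.ae_eq_mk.mono fun x hx => by simp [← hx])
    simpa only [e1, e2] using h
  have hp0 : 0 < p := hpq.pos
  have hq0 : 0 < q := hpq.symm.pos
  have hsum : 1 / q + 1 / p = 1 := by simpa using hpq.symm.inv_add_inv_eq_one
  have hK (x : E) : ∫⁻ y, k (x - y) = ∫⁻ y, k y := lintegral_sub_left_eq_self k x
  have step (x : E) : (∫⁻ y, k (x - y) * f y) ^ p
      ≤ (∫⁻ y, k y) ^ (p / q) * ∫⁻ y, k (x - y) * f y ^ p := by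
    have h := ENNReal.lintegral_mul_le_Lp_mul_Lq volume hpq.symm
      (f := fun y => k (x - y) ^ (1 / q)) (g := fun y => k (x - y) ^ (1 / p) * f y)
      (by fun_prop) (by fun_prop)
    have e1 : ∫⁻ y, ((fun y => k (x - y) ^ (1 / q)) * fun y => k (x - y) ^ (1 / p) * f y) y
        = ∫⁻ y, k (x - y) * f y := by
      refine lintegral_congr fun y => ?_
      simp only [Pi.mul_apply]
      rw [← mul_assoc, ← ENNReal.rpow_add_of_nonneg _ _ (by positivity) (by positivity), hsum,
        ENNReal.rpow_one]
    have e2 : ∫⁻ y, (k (x - y) ^ (1 / q)) ^ q = ∫⁻ y, k y := by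
      rw [← hK x]
      refine lintegral_congr fun y => ?_
      rw [← ENNReal.rpow_mul, one_div_mul_cancel hq0.ne', ENNReal.rpow_one]
    have e3 : ∫⁻ y, (k (x - y) ^ (1 / p) * f y) ^ p = ∫⁻ y, k (x - y) * f y ^ p := by
      refine lintegral_congr fun y => ?_
      rw [ENNReal.mul_rpow_of_nonneg _ _ hp0.le, ← ENNReal.rpow_mul, one_div_mul_cancel hp0.ne',
        ENNReal.rpow_one]
    rw [e1, e2, e3] at h
    calc (∫⁻ y, k (x - y) * f y) ^ p
        ≤ ((∫⁻ y, k y) ^ (1 / q) * (∫⁻ y, k (x - y) * f y ^ p) ^ (1 / p)) ^ p := by gcongr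
      _ = _ := by
        rw [ENNReal.mul_rpow_of_nonneg _ _ hp0.le, ← ENNReal.rpow_mul, ← ENNReal.rpow_mul,
          one_div_mul_cancel hp0.ne', ENNReal.rpow_one]
        congr 2
        ring
  calc ∫⁻ x, (∫⁻ y, k (x - y) * f y) ^ p
      ≤ ∫⁻ x, (∫⁻ y, k y) ^ (p / q) * ∫⁻ y, k (x - y) * f y ^ p := lintegral_mono step
    _ = (∫⁻ y, k y) ^ (p / q) * ∫⁻ x, ∫⁻ y, k (x - y) * f y ^ p := by
        rw [lintegral_const_mul]
        exact Measurable.lintegral_prod_right' (f := fun z : E × E => k (z.1 - z.2) * f z.2 ^ p)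
          (by fun_prop)
    _ = (∫⁻ y, k y) ^ (p / q) * ∫⁻ y, ∫⁻ x, k (x - y) * f y ^ p := by
        rw [lintegral_lintegral_swap]
        fun_prop
    _ = (∫⁻ y, k y) ^ (p / q) * ((∫⁻ y, k y) * ∫⁻ y, f y ^ p) := by
        congr 1
        rw [← lintegral_const_mul _ (by fun_prop)]
        refine lintegral_congr fun y => ?_
        rw [lintegral_mul_const _ (by fun_prop), lintegral_sub_right_eq_self k y]
    _ = _ := by
        rw [← mul_assoc]
        congr 1
        nth_rewrite 2 [← ENNReal.rpow_one (∫⁻ y, k y)]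
        rw [← ENNReal.rpow_add_of_nonneg _ _ (by positivity) zero_le_one]
        congr 1
        field_simp at hsum ⊢
        linarith

theorem lintegral_convolution_sq_le {k f : E → ℝ≥0∞} (hk : Measurable k) (hf : AEMeasurable f) :
    ∫⁻ x, (∫⁻ y, k (x - y) * f y) ^ 2 ≤ (∫⁻ x, k x) ^ 2 * ∫⁻ x, f x ^ 2 := by
  simpa using lintegral_convolution_rpow_le Real.HolderConjugate.two_two hk hf

theorem lintegral_mul_sq_le {f g : E → ℝ≥0∞} (hf : AEMeasurable f) (hg : AEMeasurable g) :
    (∫⁻ x, f x * g x) ^ 2 ≤ (∫⁻ x, f x ^ 2) * ∫⁻ x, g x ^ 2 := by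
  have h := ENNReal.lintegral_mul_le_Lp_mul_Lq volume Real.HolderConjugate.two_two hf hg
  simp only [Pi.mul_apply, ENNReal.rpow_ofNat] at h
  calc (∫⁻ x, f x * g x) ^ 2
      ≤ ((∫⁻ x, f x ^ 2) ^ (1 / 2 : ℝ) * (∫⁻ x, g x ^ 2) ^ (1 / 2 : ℝ)) ^ 2 := by gcongr
    _ = _ := by
      rw [mul_pow, ← ENNReal.rpow_natCast, ← ENNReal.rpow_natCast, ← ENNReal.rpow_mul,
        ← ENNReal.rpow_mul]
      norm_num

/-- A function in the weighted space `L²(|η|^{2s})` is integrable on the unit ball if `2s < d`. -/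
theorem lintegral_ball_sq_le (s : ℝ) [Nontrivial E] {G : E → ℝ≥0∞} (hG : Measurable G) :
    (∫⁻ η, (Metric.ball 0 1).indicator G η) ^ 2
      ≤ (∫⁻ η in Metric.ball (0 : E) 1, (‖η‖ₑ ^ (-s)) ^ 2) * ∫⁻ η, (‖η‖ₑ ^ s * G η) ^ 2 := by
  have hm : MeasurableSet (Metric.ball (0 : E) 1) := Metric.isOpen_ball.measurableSet
  have e1 : ∫⁻ η, (Metric.ball 0 1).indicator G η
      = ∫⁻ η, (Metric.ball 0 1).indicator (fun η => ‖η‖ₑ ^ (-s)) η * (‖η‖ₑ ^ s * G η) := by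
    refine lintegral_congr_ae ?_
    filter_upwards [compl_mem_ae_iff.2 (measure_singleton (0 : E))] with η hη
    have hη : ‖η‖ₑ ≠ 0 := by simpa using hη
    by_cases h : η ∈ Metric.ball (0 : E) 1
    · rw [Set.indicator_of_mem h, Set.indicator_of_mem h, ← mul_assoc,
        ← ENNReal.rpow_add _ _ hη (by simp)]
      simp
    · simp [Set.indicator_of_notMem h]
  rw [e1]
  refine (lintegral_mul_sq_le ?_ ?_).trans_eq ?_
  · exact (Measurable.indicator (by fun_prop) hm).aemeasurable
  · fun_prop
  · congr 1
    rw [← lintegral_indicator hm]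
    refine lintegral_congr fun η => ?_
    by_cases h : η ∈ Metric.ball (0 : E) 1 <;> simp [h]

/-- The square of the operator norm bound in `lintegral_weight_convolution_sq_le`. -/
noncomputable def weightConst (s : ℝ) (k : E → ℝ≥0∞) : ℝ≥0∞ :=
  (2 ^ s) ^ 2 * (2 * ((∫⁻ x, k x) ^ 2 + 2 * ((∫⁻ x, (‖x‖ₑ ^ s * k x) ^ 2)
    * (∫⁻ η in Metric.ball (0 : E) 1, (‖η‖ₑ ^ (-s)) ^ 2) + (∫⁻ x, ‖x‖ₑ ^ s * k x) ^ 2)))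

theorem lintegral_weight_convolution_sq_le {s : ℝ} (hs : 0 < s) [Nontrivial E] {k G : E → ℝ≥0∞}
    (hk : Measurable k) (hG : Measurable G) :
    ∫⁻ ξ, (‖ξ‖ₑ ^ s * ∫⁻ η, k (ξ - η) * G η) ^ 2
      ≤ weightConst s k * ∫⁻ η, (‖η‖ₑ ^ s * G η) ^ 2 := by
  have hm : MeasurableSet (Metric.ball (0 : E) 1) := Metric.isOpen_ball.measurableSet
  set I := ∫⁻ η, (‖η‖ₑ ^ s * G η) ^ 2 with hI
  set G₁ := (Metric.ball (0 : E) 1).indicator G with hG₁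
  set G₂ := (Metric.ball (0 : E) 1)ᶜ.indicator G with hG₂
  have mG₁ : Measurable G₁ := hG.indicator hm
  have mG₂ : Measurable G₂ := hG.indicator hm.compl
  set k' : E → ℝ≥0∞ := fun x => ‖x‖ₑ ^ s * k x with hk'
  have mk' : Measurable k' := by fun_prop
  have mconv {k f : E → ℝ≥0∞} (hk : Measurable k) (hf : Measurable f) :
      Measurable fun x => ∫⁻ y, k (x - y) * f y :=
    Measurable.lintegral_prod_right' (f := fun z : E × E => k (z.1 - z.2) * f z.2) (by fun_prop)
  set A := fun ξ : E => ∫⁻ η, k (ξ - η) * (‖η‖ₑ ^ s * G η) with hA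
  set B₁ := fun ξ : E => ∫⁻ η, k' (ξ - η) * G₁ η with hB₁
  set B₂ := fun ξ : E => ∫⁻ η, k' (ξ - η) * G₂ η with hB₂
  have mA : Measurable A := mconv hk (by fun_prop)
  have mB₁ : Measurable B₁ := mconv mk' mG₁
  have mB₂ : Measurable B₂ := mconv mk' mG₂
  have pt (ξ : E) : ‖ξ‖ₑ ^ s * ∫⁻ η, k (ξ - η) * G η ≤ 2 ^ s * (A ξ + (B₁ ξ + B₂ ξ)) := by
    calc ‖ξ‖ₑ ^ s * ∫⁻ η, k (ξ - η) * G η = ∫⁻ η, ‖ξ‖ₑ ^ s * (k (ξ - η) * G η) := by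
          rw [lintegral_const_mul _ (by fun_prop)]
      _ ≤ ∫⁻ η, 2 ^ s * (k (ξ - η) * (‖η‖ₑ ^ s * G η)
            + (k' (ξ - η) * G₁ η + k' (ξ - η) * G₂ η)) := by
          refine lintegral_mono fun η => ?_
          have hsplit : G₁ η + G₂ η = G η := Set.indicator_self_add_compl_apply _ _ _
          calc ‖ξ‖ₑ ^ s * (k (ξ - η) * G η)
              ≤ (2 ^ s * (‖η‖ₑ ^ s + ‖ξ - η‖ₑ ^ s)) * (k (ξ - η) * G η) := by
                gcongr
                exact enorm_rpow_le_mul_add _ _ hs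
            _ = _ := by
                rw [← mul_add (k' (ξ - η)), hsplit]
                simp only [hk']
                ring
      _ = _ := by
          rw [lintegral_const_mul _ (by fun_prop), lintegral_add_left (by fun_prop),
            lintegral_add_left (by fun_prop)]
  have bA : ∫⁻ ξ, A ξ ^ 2 ≤ (∫⁻ x, k x) ^ 2 * I :=
    lintegral_convolution_sq_le hk (by fun_prop)
  have bB₁ : ∫⁻ ξ, B₁ ξ ^ 2 ≤ (∫⁻ x, k' x ^ 2)
      * (∫⁻ η in Metric.ball (0 : E) 1, (‖η‖ₑ ^ (-s)) ^ 2) * I := by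
    have e (ξ : E) : B₁ ξ = ∫⁻ η, G₁ (ξ - η) * k' η := by
      simp only [hB₁]
      rw [← lintegral_sub_left_eq_self _ ξ]
      simp [mul_comm]
    simp only [e]
    refine (lintegral_convolution_sq_le mG₁ mk'.aemeasurable).trans ?_
    rw [mul_comm, mul_assoc]
    gcongr
    exact lintegral_ball_sq_le s hG
  have bB₂ : ∫⁻ ξ, B₂ ξ ^ 2 ≤ (∫⁻ x, k' x) ^ 2 * I := by
    refine (lintegral_convolution_sq_le mk' mG₂.aemeasurable).trans ?_
    gcongr
    refine lintegral_mono fun η => ?_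
    by_cases h : η ∈ Metric.ball (0 : E) 1
    · simp [hG₂, h]
    · rw [hG₂, Set.indicator_of_mem (by simpa using h)]
      gcongr
      refine le_mul_of_one_le_left' (ENNReal.one_le_rpow ?_ hs)
      rw [← ofReal_norm, ENNReal.one_le_ofReal]
      simpa using h
  calc ∫⁻ ξ, (‖ξ‖ₑ ^ s * ∫⁻ η, k (ξ - η) * G η) ^ 2
      ≤ ∫⁻ ξ, (2 ^ s) ^ 2 * (2 * (A ξ ^ 2 + 2 * (B₁ ξ ^ 2 + B₂ ξ ^ 2))) := by
        refine lintegral_mono fun ξ => ?_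
        refine (pow_le_pow_left' (pt ξ) 2).trans ?_
        rw [mul_pow]
        gcongr
        refine (ENNReal.add_sq_le_two_mul _ _).trans ?_
        gcongr
        exact ENNReal.add_sq_le_two_mul _ _
    _ = (2 ^ s) ^ 2 * (2 * ((∫⁻ ξ, A ξ ^ 2) + 2 * ((∫⁻ ξ, B₁ ξ ^ 2) + ∫⁻ ξ, B₂ ξ ^ 2))) := by
        rw [lintegral_const_mul _ (by fun_prop), lintegral_const_mul _ (by fun_prop),
          lintegral_add_left (by fun_prop), lintegral_const_mul _ (by fun_prop),
          lintegral_add_left (by fun_prop)]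
    _ ≤ (2 ^ s) ^ 2 * (2 * ((∫⁻ x, k x) ^ 2 * I + 2 * ((∫⁻ x, k' x ^ 2)
          * (∫⁻ η in Metric.ball (0 : E) 1, (‖η‖ₑ ^ (-s)) ^ 2) * I + (∫⁻ x, k' x) ^ 2 * I))) := by
        gcongr
    _ = _ := by
        rw [weightConst]
        ring

/-- The bound of `lintegral_weight_convolution_sq_le` is invariant under dilations of `k`. -/
theorem lintegral_weight_convolution_dilation_sq_le {s : ℝ} (hs : 0 < s) [Nontrivial E]
    {k G : E → ℝ≥0∞} (hk : Measurable k) (hG : Measurable G) {R : ℝ} (hR : 0 < R) :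
    ∫⁻ ξ, (‖ξ‖ₑ ^ s * ∫⁻ η, ENNReal.ofReal (R ^ Module.finrank ℝ E) * k (R • (ξ - η)) * G η) ^ 2
      ≤ weightConst s k * ∫⁻ η, (‖η‖ₑ ^ s * G η) ^ 2 := by
  have hRd : 0 < R ^ Module.finrank ℝ E := by positivity
  have hc : ENNReal.ofReal (R ^ Module.finrank ℝ E) * ENNReal.ofReal (R ^ Module.finrank ℝ E)⁻¹
      = 1 := by
    rw [← ENNReal.ofReal_mul hRd.le, mul_inv_cancel₀ hRd.ne', ENNReal.ofReal_one]
  have inner_eq (ξ : E) : ∫⁻ η, ENNReal.ofReal (R ^ Module.finrank ℝ E) * k (R • (ξ - η)) * G η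
      = ∫⁻ η, k (R • ξ - η) * G (R⁻¹ • η) := by
    have h := lintegral_comp_smul_of_pos (fun η => k (R • ξ - η) * G (R⁻¹ • η)) hR
    simp only [inv_smul_smul₀ hR.ne', ← smul_sub] at h
    simp only [mul_assoc]
    rw [lintegral_const_mul _ (by fun_prop), h, ← mul_assoc, hc, one_mul]
  have hw (ξ : E) : ‖ξ‖ₑ ^ s = ENNReal.ofReal (R⁻¹) ^ s * ‖R • ξ‖ₑ ^ s := by
    rw [← ENNReal.mul_rpow_of_nonneg _ _ hs.le, enorm_smul, Real.enorm_of_nonneg hR.le, ← mul_assoc,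
      ← ENNReal.ofReal_mul (by positivity), inv_mul_cancel₀ hR.ne', ENNReal.ofReal_one, one_mul]
  have main := lintegral_weight_convolution_sq_le hs hk (G := fun η => G (R⁻¹ • η)) (by fun_prop)
  have lhs_eq : ∫⁻ ξ, (‖ξ‖ₑ ^ s
      * ∫⁻ η, ENNReal.ofReal (R ^ Module.finrank ℝ E) * k (R • (ξ - η)) * G η) ^ 2
      = (ENNReal.ofReal (R⁻¹) ^ s) ^ 2 * (ENNReal.ofReal ((R ^ Module.finrank ℝ E)⁻¹)
        * ∫⁻ ξ, (‖ξ‖ₑ ^ s * ∫⁻ η, k (ξ - η) * G (R⁻¹ • η)) ^ 2) := by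
    rw [← lintegral_comp_smul_of_pos _ hR, ← lintegral_const_mul' _ _ (by finiteness)]
    refine lintegral_congr fun ξ => ?_
    rw [inner_eq, hw, ← mul_pow, mul_assoc]
  have rhs_eq : ∫⁻ η, (‖η‖ₑ ^ s * G η) ^ 2
      = (ENNReal.ofReal (R⁻¹) ^ s) ^ 2 * (ENNReal.ofReal ((R ^ Module.finrank ℝ E)⁻¹)
        * ∫⁻ η, (‖η‖ₑ ^ s * G (R⁻¹ • η)) ^ 2) := by
    rw [← lintegral_comp_smul_of_pos _ hR, ← lintegral_const_mul' _ _ (by finiteness)]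
    refine lintegral_congr fun ξ => ?_
    rw [hw, ← mul_pow, inv_smul_smul₀ hR.ne', mul_assoc]
  rw [lhs_eq, rhs_eq]
  calc _ ≤ (ENNReal.ofReal (R⁻¹) ^ s) ^ 2 * (ENNReal.ofReal ((R ^ Module.finrank ℝ E)⁻¹)
        * (weightConst s k * ∫⁻ η, (‖η‖ₑ ^ s * G (R⁻¹ • η)) ^ 2)) := by gcongr
    _ = _ := by ring

theorem lintegral_ball_enorm_rpow_lt_top {s : ℝ} (hs : 2 * s < Module.finrank ℝ E)
    [Nontrivial E] : ∫⁻ η in Metric.ball (0 : E) 1, (‖η‖ₑ ^ (-s)) ^ 2 < ⊤ := by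
  have h := integrableOn_ball_of_norm_le_rpow (μ := (volume : Measure E)) (r := 1)
    (f := fun x : E => ‖x‖ ^ (-(2 * s))) (C := 1)
    Module.finrank_pos hs (Filter.Eventually.of_forall fun x => by
      rw [one_mul, Real.norm_of_nonneg (by positivity)])
    (by fun_prop : Measurable fun x : E => ‖x‖ ^ (-(2 * s))).aestronglyMeasurable
  refine lt_of_le_of_lt (lintegral_mono_ae ?_) h.2
  refine ae_restrict_of_ae ?_
  filter_upwards [compl_mem_ae_iff.2 (measure_singleton (0 : E))] with η hη
  have hη : 0 < ‖η‖ := by simpa using hη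
  rw [← ENNReal.rpow_natCast, ← ENNReal.rpow_mul, ← ofReal_norm, ENNReal.ofReal_rpow_of_pos hη,
    Real.enorm_of_nonneg (by positivity)]
  refine ENNReal.ofReal_le_ofReal (le_of_eq ?_)
  congr 1
  push_cast
  ring

end LIntegral

theorem nontrivial_eucl {d : ℕ} (s : ℝ) [hs : Fact (0 < s ∧ s < (d : ℝ) / 2)] :
    Nontrivial (Eucl d) := by
  refine Module.nontrivial_of_finrank_pos (R := ℝ) ?_
  rw [finrank_euclideanSpace_fin]
  refine Nat.pos_of_ne_zero ?_
  rintro rfl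
  have := hs.out
  norm_num at this
  linarith

namespace SchwartzMap

variable {d : ℕ} (φ : 𝓢(Eucl d, ℂ))

theorem integrable_rpow_mul {r : ℝ} (hr : 0 ≤ r) :
    Integrable (fun ξ => ‖ξ‖ ^ r * ‖φ ξ‖) volume := by
  have hm : Measurable fun ξ : Eucl d => ‖ξ‖ ^ r := by fun_prop
  obtain ⟨k, hk⟩ := exists_nat_ge r
  refine (φ.integrable.norm.add (φ.integrable_pow_mul volume k)).mono'
    (hm.aestronglyMeasurable.mul φ.continuous.aestronglyMeasurable.norm) ?_
  refine Filter.Eventually.of_forall fun ξ => ?_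
  have h1 : ‖ξ‖ ^ r ≤ 1 + ‖ξ‖ ^ k := by
    rcases le_total ‖ξ‖ 1 with h | h
    · have := Real.rpow_le_one (norm_nonneg ξ) h hr
      have : 0 ≤ ‖ξ‖ ^ k := by positivity
      linarith
    · have := Real.rpow_le_rpow_of_exponent_le h hk
      rw [Real.rpow_natCast] at this
      linarith
  rw [Real.norm_of_nonneg (by positivity)]
  simp only [Pi.add_apply]
  calc ‖ξ‖ ^ r * ‖φ ξ‖ ≤ (1 + ‖ξ‖ ^ k) * ‖φ ξ‖ := by gcongr
    _ = _ := by ring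

theorem exists_enorm_le : ∃ C : ℝ≥0∞, C ≠ ⊤ ∧ ∀ ξ, ‖φ ξ‖ₑ ≤ C := by
  refine ⟨ENNReal.ofReal (SchwartzMap.seminorm ℝ 0 0 φ), ENNReal.ofReal_ne_top, fun ξ => ?_⟩
  rw [← ofReal_norm]
  exact ENNReal.ofReal_le_ofReal (SchwartzMap.norm_le_seminorm ℝ φ ξ)

theorem lintegral_rpow_mul_lt_top {r : ℝ} (hr : 0 ≤ r) :
    ∫⁻ ξ, ‖ξ‖ₑ ^ r * ‖φ ξ‖ₑ < ⊤ := by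
  refine lt_of_le_of_lt (lintegral_mono fun ξ => le_of_eq ?_) (φ.integrable_rpow_mul hr).2
  rw [enorm_mul, Real.enorm_rpow_of_nonneg (norm_nonneg ξ) hr, enorm_norm, enorm_norm]

theorem lintegral_rpow_mul_sq_lt_top {r : ℝ} (hr : 0 ≤ r) :
    ∫⁻ ξ, (‖ξ‖ₑ ^ r * ‖φ ξ‖ₑ) ^ 2 < ⊤ := by
  obtain ⟨C, hC, hφ⟩ := φ.exists_enorm_le
  refine lt_of_le_of_lt (b := ∫⁻ ξ, C * (‖ξ‖ₑ ^ (2 * r) * ‖φ ξ‖ₑ)) (lintegral_mono fun ξ => ?_) ?_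
  · calc (‖ξ‖ₑ ^ r * ‖φ ξ‖ₑ) ^ 2 = ‖φ ξ‖ₑ * (‖ξ‖ₑ ^ (2 * r) * ‖φ ξ‖ₑ) := by
          rw [two_mul, ENNReal.rpow_add_of_nonneg _ _ hr hr]
          ring
      _ ≤ _ := by
          gcongr
          exact hφ ξ
  · rw [lintegral_const_mul' _ _ hC]
    exact ENNReal.mul_lt_top hC.lt_top (φ.lintegral_rpow_mul_lt_top (by positivity))

theorem lintegral_rpow_neg_mul_sq_lt_top {s : ℝ} [hs : Fact (0 < s ∧ s < (d : ℝ) / 2)] :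
    ∫⁻ ξ, (‖ξ‖ₑ ^ (-s) * ‖φ ξ‖ₑ) ^ 2 < ⊤ := by
  have := nontrivial_eucl (d := d) s
  obtain ⟨C, hC, hφ⟩ := φ.exists_enorm_le
  rw [← lintegral_add_compl _ (Metric.isOpen_ball (x := (0 : Eucl d)) (ε := 1)).measurableSet]
  refine ENNReal.add_lt_top.2 ⟨?_, ?_⟩
  · refine lt_of_le_of_lt (b := ∫⁻ ξ in Metric.ball (0 : Eucl d) 1, C ^ 2 * (‖ξ‖ₑ ^ (-s)) ^ 2)
      (lintegral_mono fun ξ => ?_) ?_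
    · rw [mul_pow, mul_comm]
      gcongr
      exact hφ ξ
    · rw [lintegral_const_mul' _ _ (by finiteness)]
      refine ENNReal.mul_lt_top (by finiteness) (lintegral_ball_enorm_rpow_lt_top ?_)
      rw [finrank_euclideanSpace_fin]
      linarith [hs.out.2]
  · refine lt_of_le_of_lt ?_ (φ.lintegral_rpow_mul_sq_lt_top le_rfl)
    refine (setLIntegral_mono' (Metric.isOpen_ball.measurableSet.compl) fun ξ hξ => ?_).trans
      (setLIntegral_le_lintegral _ _)
    have h1 : 1 ≤ ‖ξ‖ₑ := by
      rw [← ofReal_norm, ENNReal.one_le_ofReal]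
      simpa using hξ
    gcongr (?_ * _) ^ 2
    exact ENNReal.rpow_le_rpow_of_exponent_le h1 (by linarith [hs.out.1])

/-- A Schwartz function is integrable against functions in `L²(|ξ|^{2s})`, if `2s < d`. -/
theorem lintegral_mul_lt_top {s : ℝ} [hs : Fact (0 < s ∧ s < (d : ℝ) / 2)] {F : Eucl d → ℝ≥0∞}
    (hF : AEMeasurable F) (hF2 : ∫⁻ ξ, (‖ξ‖ₑ ^ s * F ξ) ^ 2 < ⊤) :
    ∫⁻ ξ, ‖φ ξ‖ₑ * F ξ < ⊤ := by
  have := nontrivial_eucl (d := d) s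
  have e : ∫⁻ ξ, ‖φ ξ‖ₑ * F ξ = ∫⁻ ξ, (‖ξ‖ₑ ^ (-s) * ‖φ ξ‖ₑ) * (‖ξ‖ₑ ^ s * F ξ) := by
    refine lintegral_congr_ae ?_
    filter_upwards [compl_mem_ae_iff.2 (measure_singleton (0 : Eucl d))] with ξ hξ
    have hξ : ‖ξ‖ₑ ≠ 0 := by simpa using hξ
    have h1 : ‖ξ‖ₑ ^ (-s) * ‖ξ‖ₑ ^ s = 1 := by
      rw [← ENNReal.rpow_add _ _ hξ (by simp)]
      simp
    rw [mul_mul_mul_comm, h1, one_mul]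
  have hφm : Measurable fun ξ => ‖φ ξ‖ₑ := φ.continuous.measurable.enorm
  have h := lintegral_mul_sq_le (f := fun ξ => ‖ξ‖ₑ ^ (-s) * ‖φ ξ‖ₑ)
    (g := fun ξ => ‖ξ‖ₑ ^ s * F ξ) (by fun_prop) (by fun_prop)
  rw [← e] at h
  have h2 := h.trans_lt (ENNReal.mul_lt_top φ.lintegral_rpow_neg_mul_sq_lt_top hF2)
  simpa using h2

theorem weightConst_lt_top {s : ℝ} [hs : Fact (0 < s ∧ s < (d : ℝ) / 2)] :
    weightConst s (fun ξ => ‖φ ξ‖ₑ) < ⊤ := by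
  have := nontrivial_eucl (d := d) s
  have h1 : ∫⁻ x, ‖φ x‖ₑ < ⊤ := φ.integrable.2
  have h2 := φ.lintegral_rpow_mul_sq_lt_top hs.out.1.le
  have h3 := φ.lintegral_rpow_mul_lt_top hs.out.1.le
  have h4 : ∫⁻ η in Metric.ball (0 : Eucl d) 1, (‖η‖ₑ ^ (-s)) ^ 2 < ⊤ := by
    refine lintegral_ball_enorm_rpow_lt_top ?_
    rw [finrank_euclideanSpace_fin]
    linarith [hs.out.2]
  have h5 : (2 : ℝ≥0∞) ^ s < ⊤ := ENNReal.rpow_lt_top_of_nonneg hs.out.1.le (by simp)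
  unfold weightConst
  finiteness

end SchwartzMap

open Real in
theorem fourier_fourierChar_smul {d : ℕ} (f : Eucl d → ℂ) (η ξ : Eucl d) :
    𝓕 (fun x => 𝐞 (inner ℝ x η) • f x) ξ = 𝓕 f (ξ - η) := by
  rw [Real.fourier_eq, Real.fourier_eq]
  refine integral_congr_ae (Filter.Eventually.of_forall fun x => ?_)
  simp only [smul_smul]
  rw [← AddChar.map_add_eq_mul, inner_sub_right]
  congr 2
  ring

open Real in
theorem integral_fourier_mul_eq_of_integrable {d : ℕ} {f g : Eucl d → ℂ} (hf : Integrable f)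
    (hg : Integrable g) : ∫ ξ, 𝓕 f ξ * g ξ = ∫ x, f x * 𝓕 g x := by
  simpa using! VectorFourier.integral_fourierIntegral_smul_eq_flip (L := innerₗ (Eucl d))
    continuous_fourierChar continuous_inner hf hg

open Real in
/-- The Fourier multiplier with Schwartz symbol `Θ` is the convolution with the reflection of
`𝓕 Θ`. -/
theorem SchwartzMap.fourierMultiplierCLM_apply_eq_integral {d : ℕ} (Θ φ : 𝓢(Eucl d, ℂ))
    (η : Eucl d) :
    SchwartzMap.fourierMultiplierCLM ℂ Θ φ η = ∫ ξ, 𝓕 Θ (ξ - η) * φ ξ := by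
  have hΘ : Integrable (fun x => 𝐞 (inner ℝ x η) • Θ x) := by
    have := (Real.fourierIntegral_convergent_iff (f := Θ) (μ := volume) (-η)).2 Θ.integrable
    simpa using this
  have h := integral_fourier_mul_eq_of_integrable hΘ φ.integrable
  simp only [fourier_fourierChar_smul] at h
  rw [SchwartzMap.fourierMultiplierCLM_apply, SchwartzMap.fourierInv_coe, Real.fourierInv_eq,
    SchwartzMap.fourier_coe, h]
  refine integral_congr_ae (Filter.Eventually.of_forall fun x => ?_)
  simp only [SchwartzMap.smulLeftCLM_apply_apply Θ.hasTemperateGrowth, Circle.smul_def,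
    smul_eq_mul, SchwartzMap.fourier_coe, mul_assoc]

theorem IsFourierTransformOf.of_integrable {d : ℕ} {v : Eucl d → ℝ} (hv : Integrable v) :
    IsFourierTransformOf v (𝓕 fun x => (v x : ℂ)) := by
  have hc : Continuous (𝓕 fun x => (v x : ℂ)) :=
    VectorFourier.fourierIntegral_continuous Real.continuous_fourierChar continuous_inner hv.ofReal
  refine ⟨hc.aestronglyMeasurable, fun φ => ?_, fun φ => ?_⟩
  · refine φ.integrable.bdd_mul hc.aestronglyMeasurable (c := ∫ x, ‖(v x : ℂ)‖)
      (Filter.Eventually.of_forall fun ξ => ?_)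
    exact VectorFourier.norm_fourierIntegral_le_integral_norm _ _ _ _ _
  · rw [SchwartzMap.fourier_coe]
    exact (integral_fourier_mul_eq_of_integrable hv.ofReal φ.integrable).symm

/-- The Fourier transform of the product of `u` with a real-valued Schwartz function `Θ` is the
convolution `𝓕 Θ * û`. -/
theorem IsFourierTransformOf.mul {d : ℕ} {u : Eucl d → ℝ} {g : Eucl d → ℂ}
    (hg : IsFourierTransformOf u g) {θ : Eucl d → ℝ} {Θ : 𝓢(Eucl d, ℂ)} (hΘ : ∀ x, Θ x = θ x)
    (hfin : ∀ φ : 𝓢(Eucl d, ℂ), ∫⁻ ξ, ‖φ ξ‖ₑ * ∫⁻ η, ‖𝓕 Θ (ξ - η)‖ₑ * ‖g η‖ₑ < ⊤) :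
    IsFourierTransformOf (fun x => θ x * u x) (fun ξ => ∫ η, 𝓕 Θ (ξ - η) * g η) := by
  have hK : Continuous ⇑(𝓕 Θ : 𝓢(Eucl d, ℂ)) := SchwartzMap.continuous _
  have hmeas : AEStronglyMeasurable (fun z : Eucl d × Eucl d => 𝓕 Θ (z.1 - z.2) * g z.2)
      (volume.prod volume) := by
    refine AEStronglyMeasurable.mul ?_ hg.aestronglyMeasurable.comp_snd
    exact (hK.comp (by fun_prop)).aestronglyMeasurable
  have hint (φ : 𝓢(Eucl d, ℂ)) : Integrable (fun z : Eucl d × Eucl d =>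
      𝓕 Θ (z.1 - z.2) * g z.2 * φ z.1) (volume.prod volume) := by
    have hm : AEStronglyMeasurable (fun z : Eucl d × Eucl d =>
        𝓕 Θ (z.1 - z.2) * g z.2 * φ z.1) (volume.prod volume) := hmeas.mul ((φ.continuous.comp continuous_fst).aestronglyMeasurable
      (μ := volume.prod (volume : Measure (Eucl d))))
    refine ⟨hm, ?_⟩
    rw [HasFiniteIntegral, lintegral_prod _ hm.enorm]
    refine lt_of_le_of_lt (lintegral_mono fun ξ => le_of_eq ?_) (hfin φ)
    simp only [enorm_mul]
    rw [← lintegral_const_mul' _ _ (by simp)]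
    exact lintegral_congr fun η => by ring
  refine ⟨hmeas.integral_prod_right', fun φ => ?_, fun φ => ?_⟩
  · refine (hint φ).integral_prod_left.congr (Filter.Eventually.of_forall fun ξ => ?_)
    simp only [integral_mul_const]
  · have h := hg.integral_eq (SchwartzMap.fourierMultiplierCLM ℂ Θ φ)
    calc ∫ x, ((θ x * u x : ℝ) : ℂ) * 𝓕 φ x
        = ∫ x, (u x : ℂ) * 𝓕 (SchwartzMap.fourierMultiplierCLM ℂ Θ φ) x := by
          refine integral_congr_ae (Filter.Eventually.of_forall fun x => ?_)
          simp only [SchwartzMap.fourierMultiplierCLM_apply,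
            FourierTransform.fourier_fourierInv_eq,
            SchwartzMap.smulLeftCLM_apply_apply Θ.hasTemperateGrowth, hΘ, smul_eq_mul,
            Complex.ofReal_mul]
          ring
      _ = ∫ η, ∫ ξ, 𝓕 Θ (ξ - η) * g η * φ ξ := by
          rw [h]
          refine integral_congr_ae (Filter.Eventually.of_forall fun η => ?_)
          simp only [SchwartzMap.fourierMultiplierCLM_apply_eq_integral]
          rw [← integral_const_mul]
          exact integral_congr_ae (Filter.Eventually.of_forall fun ξ => by ring)
      _ = ∫ ξ, ∫ η, 𝓕 Θ (ξ - η) * g η * φ ξ := (integral_integral_swap (hint φ)).symm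
      _ = _ := by simp only [integral_mul_const]

theorem IsFourierTransformOf.congr_right {d : ℕ} {u : Eucl d → ℝ} {g h : Eucl d → ℂ}
    (hg : IsFourierTransformOf u g) (hgh : g =ᵐ[volume] h) : IsFourierTransformOf u h where
  aestronglyMeasurable := hg.aestronglyMeasurable.congr hgh
  integrable_mul φ := (hg.integrable_mul φ).congr (hgh.mono fun x hx => by simp [hx])
  integral_eq φ := by
    rw [hg.integral_eq φ]
    exact integral_congr_ae (hgh.mono fun x hx => by simp [hx])

theorem enorm_weight_sq {d : ℕ} {s : ℝ} (hs : 0 ≤ s) (ξ : Eucl d) (z : ℂ) :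
    (‖ξ‖ₑ ^ s * ‖z‖ₑ) ^ 2 = ENNReal.ofReal (‖ξ‖ ^ (2 * s) * ‖z‖ ^ 2) := by
  rw [← norm_weight_sq, ENNReal.ofReal_pow (norm_nonneg _), ofReal_norm, enorm_smul,
    Real.enorm_rpow_of_nonneg (norm_nonneg ξ) hs, enorm_norm]

theorem integrable_weight_sq {d : ℕ} {s : ℝ} (hs : 0 ≤ s) {g : Eucl d → ℂ}
    (hg : AEStronglyMeasurable g volume) (hfin : ∫⁻ ξ, (‖ξ‖ₑ ^ s * ‖g ξ‖ₑ) ^ 2 < ⊤) :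
    Integrable (fun ξ => ‖ξ‖ ^ (2 * s) * ‖g ξ‖ ^ 2) volume := by
  have hm : Measurable fun ξ : Eucl d => ‖ξ‖ ^ (2 * s) := by fun_prop
  refine ⟨hm.aestronglyMeasurable.mul (hg.norm.pow 2), ?_⟩
  rw [hasFiniteIntegral_iff_ofReal (Filter.Eventually.of_forall fun ξ => by positivity)]
  simpa only [← enorm_weight_sq hs] using hfin

section Dilation

variable {d : ℕ} {θ : Eucl d → ℝ}

theorem HasCompactSupport.comp_inv_smul (hc : HasCompactSupport θ) {R : ℝ} (hR : 0 < R) :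
    HasCompactSupport fun x => θ (R⁻¹ • x) :=
  hc.comp_homeomorph (Homeomorph.smulOfNeZero R⁻¹ (inv_ne_zero hR.ne'))

theorem ContDiff.comp_inv_smul (hθ : ContDiff ℝ ∞ θ) (R : ℝ) :
    ContDiff ℝ ∞ fun x => θ (R⁻¹ • x) :=
  hθ.comp (contDiff_const_smul _)

/-- A test function seen as a complex-valued Schwartz function. -/
noncomputable def complexSchwartz (hθ : ContDiff ℝ ∞ θ) (hc : HasCompactSupport θ) :
    𝓢(Eucl d, ℂ) :=
  (hc.comp_left (g := fun t : ℝ => (t : ℂ)) (by simp)).toSchwartzMap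
    (Complex.ofRealCLM.contDiff.comp hθ)

theorem complexSchwartz_apply (hθ : ContDiff ℝ ∞ θ) (hc : HasCompactSupport θ) (x : Eucl d) :
    complexSchwartz hθ hc x = θ x := rfl

theorem fourier_complexSchwartz_comp_inv_smul (hθ : ContDiff ℝ ∞ θ) (hc : HasCompactSupport θ)
    {R : ℝ} (hR : 0 < R) (ξ : Eucl d) :
    𝓕 (complexSchwartz (hθ.comp_inv_smul R) (hc.comp_inv_smul hR)) ξ
      = (R ^ d : ℝ) • 𝓕 (complexSchwartz hθ hc) (R • ξ) := by
  rw [SchwartzMap.fourier_coe, SchwartzMap.fourier_coe, Real.fourier_eq, Real.fourier_eq]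
  have h := Measure.integral_comp_inv_smul_of_nonneg volume
    (fun x : Eucl d => Real.fourierChar (-inner ℝ x (R • ξ)) • (θ x : ℂ)) hR.le
  rw [finrank_euclideanSpace_fin] at h
  simp only [complexSchwartz_apply]
  rw [← h]
  refine integral_congr_ae (Filter.Eventually.of_forall fun x => ?_)
  simp only [inner_smul_left, inner_smul_right]
  congr 3
  simp [hR.ne']

end Dilation

namespace HomSobolev

variable {d : ℕ} {s : ℝ} [hs : Fact (0 < s ∧ s < (d : ℝ) / 2)]

theorem sq_norm_eq {u : HomSobolev d s} {g : Eucl d → ℂ} (hg : IsFourierTransformOf u g) :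
    ‖u‖ ^ 2 = ∫ ξ, ‖ξ‖ ^ (2 * s) * ‖g ξ‖ ^ 2 := by
  rw [norm_def, Real.sq_sqrt (integral_nonneg fun ξ => by positivity)]
  refine integral_congr_ae ?_
  filter_upwards [u.isFourierTransformOf_fourier.ae_eq hg ae_eq_rfl] with ξ hξ
  rw [hξ]

theorem ofReal_sq_norm_eq {u : HomSobolev d s} {g : Eucl d → ℂ} (hg : IsFourierTransformOf u g) :
    ENNReal.ofReal (‖u‖ ^ 2) = ∫⁻ ξ, (‖ξ‖ₑ ^ s * ‖g ξ‖ₑ) ^ 2 := by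
  have hi : Integrable (fun ξ => ‖ξ‖ ^ (2 * s) * ‖g ξ‖ ^ 2) volume := by
    refine u.integrable_fourier.congr ?_
    filter_upwards [u.isFourierTransformOf_fourier.ae_eq hg ae_eq_rfl] with ξ hξ
    rw [hξ]
  rw [sq_norm_eq hg, ofReal_integral_eq_lintegral_ofReal hi
    (Filter.Eventually.of_forall fun ξ => by positivity)]
  simp only [enorm_weight_sq hs.out.1.le]

/-- The element of `H̊ˢ(ℝᵈ)` given by a function and its Fourier transform. -/
noncomputable def ofFunction {v : Eucl d → ℝ} {g : Eucl d → ℂ}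
    (hv : MemLp v (sobolevExponent d s) volume) (hg : IsFourierTransformOf v g)
    (hi : Integrable (fun ξ => ‖ξ‖ ^ (2 * s) * ‖g ξ‖ ^ 2) volume) : HomSobolev d s :=
  ⟨hv.toLp, g, hg.congr_ae hv.coeFn_toLp.symm, hi⟩

theorem coe_ofFunction {v : Eucl d → ℝ} {g : Eucl d → ℂ}
    (hv : MemLp v (sobolevExponent d s) volume) (hg : IsFourierTransformOf v g)
    (hi : Integrable (fun ξ => ‖ξ‖ ^ (2 * s) * ‖g ξ‖ ^ 2) volume) :
    ⇑(ofFunction hv hg hi : HomSobolev d s) =ᵐ[volume] v := hv.coeFn_toLp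

/-- Multiplication with the dilations `θ(x / R)` of a test function is bounded on `H̊ˢ(ℝᵈ)`,
uniformly in `R`. -/
theorem exists_cutoff_mul {θ : Eucl d → ℝ} (hθ : ContDiff ℝ ∞ θ) (hc : HasCompactSupport θ) :
    ∃ C : ℝ, ∀ (u : HomSobolev d s) (R : ℝ), 0 < R → ∃ w : HomSobolev d s,
      ⇑w =ᵐ[volume] (fun x => θ (R⁻¹ • x) * u x) ∧ ‖w‖ ^ 2 ≤ C * ‖u‖ ^ 2 := by
  have := nontrivial_eucl (d := d) s
  have hs0 : 0 < s := hs.out.1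
  set K : 𝓢(Eucl d, ℂ) := 𝓕 (complexSchwartz hθ hc) with hK
  have hKm : Measurable fun ξ => ‖K ξ‖ₑ := K.continuous.measurable.enorm
  have hC := K.weightConst_lt_top (s := s)
  refine ⟨(weightConst s fun ξ => ‖K ξ‖ₑ).toReal, fun u R hR => ?_⟩
  set Θ := complexSchwartz (hθ.comp_inv_smul R) (hc.comp_inv_smul hR) with hΘ
  have hu := u.isFourierTransformOf_fourier
  set g := hu.aestronglyMeasurable.mk u.fourier with hg
  have hgm : StronglyMeasurable g := hu.aestronglyMeasurable.stronglyMeasurable_mk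
  have hug : IsFourierTransformOf u g := hu.congr_right hu.aestronglyMeasurable.ae_eq_mk
  have hGm : Measurable fun η => ‖g η‖ₑ := hgm.measurable.enorm
  have hΘK (ξ : Eucl d) : ‖𝓕 Θ ξ‖ₑ = ENNReal.ofReal (R ^ d) * ‖K (R • ξ)‖ₑ := by
    rw [hΘ, fourier_complexSchwartz_comp_inv_smul hθ hc hR, enorm_smul,
      Real.enorm_of_nonneg (by positivity)]
  have key := lintegral_weight_convolution_dilation_sq_le hs0 hKm hGm hR
  simp only [finrank_euclideanSpace_fin, ← hΘK, ← ofReal_sq_norm_eq hug] at key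
  have hfin := key.trans_lt (ENNReal.mul_lt_top hC ENNReal.ofReal_lt_top)
  have hFm : Measurable fun ξ => ∫⁻ η, ‖𝓕 Θ (ξ - η)‖ₑ * ‖g η‖ₑ := by
    refine Measurable.lintegral_prod_right'
      (f := fun z : Eucl d × Eucl d => ‖𝓕 Θ (z.1 - z.2)‖ₑ * ‖g z.2‖ₑ) ?_
    have h1 : Measurable fun ξ => ‖𝓕 Θ ξ‖ₑ := (SchwartzMap.continuous _).measurable.enorm
    exact (h1.comp (measurable_fst.sub measurable_snd)).mul (hGm.comp measurable_snd)
  have hw := hug.mul (θ := fun x => θ (R⁻¹ • x)) (Θ := Θ) (fun x => rfl)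
    (fun φ => φ.lintegral_mul_lt_top hFm.aemeasurable hfin)
  have hle : ∫⁻ ξ, (‖ξ‖ₑ ^ s * ‖∫ η, 𝓕 Θ (ξ - η) * g η‖ₑ) ^ 2
      ≤ ∫⁻ ξ, (‖ξ‖ₑ ^ s * ∫⁻ η, ‖𝓕 Θ (ξ - η)‖ₑ * ‖g η‖ₑ) ^ 2 := by
    refine lintegral_mono fun ξ => ?_
    gcongr
    simpa only [enorm_mul] using enorm_integral_le_lintegral_enorm fun η => 𝓕 Θ (ξ - η) * g η
  obtain ⟨M, hM⟩ := hc.exists_bound_of_continuous hθ.continuous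
  have hwL : MemLp (fun x => θ (R⁻¹ • x) * u x) (sobolevExponent d s) volume := by
    refine u.memLp.of_le_mul (c := M) ?_ (Filter.Eventually.of_forall fun x => ?_)
    · exact ((hθ.comp_inv_smul R).continuous.aestronglyMeasurable).mul u.memLp.1
    · rw [norm_mul]
      gcongr
      exact hM _
  refine ⟨ofFunction hwL hw (integrable_weight_sq hs0.le hw.aestronglyMeasurable
    (hle.trans_lt hfin)), coe_ofFunction _ _ _, ?_⟩
  have h2 := (hle.trans key)
  rw [← ofReal_sq_norm_eq (hw.congr_ae (coe_ofFunction hwL hw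
    (integrable_weight_sq hs0.le hw.aestronglyMeasurable (hle.trans_lt hfin))).symm)] at h2
  rw [← ENNReal.ofReal_toReal hC.ne, ← ENNReal.ofReal_mul ENNReal.toReal_nonneg] at h2
  exact (ENNReal.ofReal_le_ofReal_iff (by positivity)).1 h2

end HomSobolev

/-- A bounded sequence in a Hilbert space converges weakly to `0` if it does so when tested against
a total set. -/
theorem tendsto_inner_zero_of_total {H : Type*} [NormedAddCommGroup H] [InnerProductSpace ℂ H]
    [CompleteSpace H] {x : ℕ → H} {C : ℝ} (hx : ∀ n, ‖x n‖ ≤ C) {D : Set H}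
    (hD : ∀ w, (∀ v ∈ D, inner ℂ v w = 0) → w = 0)
    (h : ∀ v ∈ D, Tendsto (fun n => inner ℂ v (x n)) atTop (𝓝 0)) (w : H) :
    Tendsto (fun n => inner ℂ w (x n)) atTop (𝓝 0) := by
  let S : Submodule ℂ H :=
    { carrier := {w | Tendsto (fun n => inner ℂ w (x n)) atTop (𝓝 0)}
      add_mem' := fun {a b} ha hb => by
        simpa [inner_add_left] using! Tendsto.add ha hb
      zero_mem' := by simp
      smul_mem' := fun c a ha => by
        simpa [inner_smul_left, mul_comm] using! Tendsto.const_mul (starRingEnd ℂ c) ha }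
  have hS : S.topologicalClosure = ⊤ := by
    rw [Submodule.topologicalClosure_eq_top_iff, Submodule.eq_bot_iff]
    intro w hw
    exact hD w fun v hv => (Submodule.mem_orthogonal S w).1 hw v (h v hv)
  have hw : w ∈ closure (S : Set H) := by
    rw [← Submodule.topologicalClosure_coe, hS]
    trivial
  have hC : 0 ≤ C := (norm_nonneg _).trans (hx 0)
  rw [Metric.tendsto_atTop]
  intro ε hε
  obtain ⟨v, hv, hvw⟩ := Metric.mem_closure_iff.1 hw (ε / (2 * (C + 1))) (by positivity)
  obtain ⟨N, hN⟩ := Metric.tendsto_atTop.1 (show Tendsto _ _ _ from hv) (ε / 2) (by positivity)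
  refine ⟨N, fun n hn => ?_⟩
  have h1 := hN n hn
  rw [dist_zero_right] at h1 ⊢
  have h2 : ‖inner ℂ (w - v) (x n)‖ ≤ ε / (2 * (C + 1)) * C := by
    refine (norm_inner_le_norm _ _).trans ?_
    rw [← dist_eq_norm]
    gcongr
    exact hx n
  have h3 : ε / (2 * (C + 1)) * C ≤ ε / 2 := by
    rw [div_mul_eq_mul_div, div_le_div_iff₀ (by positivity) (by positivity)]
    nlinarith
  calc ‖inner ℂ w (x n)‖ = ‖inner ℂ (w - v) (x n) + inner ℂ v (x n)‖ := by
        rw [← inner_add_left, sub_add_cancel]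
    _ ≤ _ := norm_add_le _ _
    _ < ε := by linarith

theorem contDiff_norm_rpow_mul {d : ℕ} (s : ℝ) {φ : Eucl d → ℝ} (hφ : ContDiff ℝ ∞ φ)
    (h0 : tsupport φ ⊆ {0}ᶜ) : ContDiff ℝ ∞ fun ξ => ‖ξ‖ ^ s * φ ξ := by
  rw [contDiff_iff_contDiffAt]
  intro ξ
  by_cases hξ : ξ = 0
  · have hξ' : ξ ∉ tsupport φ := fun h => h0 h hξ
    have : (fun ξ => ‖ξ‖ ^ s * φ ξ) =ᶠ[𝓝 ξ] fun _ => 0 := by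
      filter_upwards [notMem_tsupport_iff_eventuallyEq.1 hξ'] with y hy
      simp [hy]
    exact contDiffAt_const.congr_of_eventuallyEq this
  · exact ((contDiffAt_id.norm ℝ hξ).rpow_const_of_ne (norm_ne_zero_iff.2 hξ)).mul hφ.contDiffAt

namespace HomSobolev

variable {d : ℕ} {s : ℝ} [hs : Fact (0 < s ∧ s < (d : ℝ) / 2)]

variable (d s) in
/-- The isometric embedding `u ↦ |ξ|^s û` of `H̊ˢ(ℝᵈ)` into `L²(ℝᵈ)`. -/
noncomputable def weightL2 : HomSobolev d s →ₗᵢ[ℝ] Lp ℂ 2 (volume : Measure (Eucl d)) where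
  toFun u := u.memLp_weight.toLp
  map_add' u v := by
    rw [← MemLp.toLp_add]
    refine (MemLp.toLp_eq_toLp_iff _ _).2 ((fourier_add u v).mono fun ξ hξ => ?_)
    simp only [hξ, Pi.add_apply, smul_add]
  map_smul' c u := by
    rw [RingHom.id_apply, ← MemLp.toLp_const_smul]
    refine (MemLp.toLp_eq_toLp_iff _ _).2 ((fourier_smul c u).mono fun ξ hξ => ?_)
    simp only [hξ, Pi.smul_apply]
    rw [smul_comm]
  norm_map' u := u.norm_eq_toLp.symm

theorem inner_weightL2 {φ : Eucl d → ℝ} (hφ : ContDiff ℝ ∞ φ) (hc : HasCompactSupport φ)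
    (h0 : tsupport φ ⊆ {0}ᶜ) (u : HomSobolev d s) :
    inner ℂ (((complexSchwartz hφ hc).memLp 2 volume).toLp) (weightL2 d s u)
      = ∫ x, (u x : ℂ) * 𝓕 (complexSchwartz (contDiff_norm_rpow_mul s hφ h0) hc.mul_left) x := by
  rw [u.isFourierTransformOf_fourier.integral_eq, L2.inner_def]
  refine integral_congr_ae ?_
  filter_upwards [((complexSchwartz hφ hc).memLp 2 volume).coeFn_toLp,
    u.memLp_weight.coeFn_toLp] with ξ h1 h2
  rw [h1, show weightL2 d s u = u.memLp_weight.toLp from rfl, h2]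
  simp only [complexSchwartz_apply, RCLike.inner_apply, Complex.conj_ofReal, Complex.real_smul,
    Complex.ofReal_mul]
  ring

/-- Every functional on `H̊ˢ(ℝᵈ)` is the real part of an inner product in `L²(ℝᵈ)`. -/
theorem exists_dual_eq_re_inner (Λ : HomSobolevDual d s) :
    ∃ w : Lp ℂ 2 (volume : Measure (Eucl d)), ∀ u, Λ u = (inner ℂ w (weightL2 d s u)).re := by
  let J := (weightL2 d s).toLinearMap
  let e := (weightL2 d s).equivRange
  obtain ⟨F, hF, -⟩ := exists_extension_norm_eq (𝕜 := ℝ) (LinearMap.range J)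
    (Λ ∘L (e.symm.toContinuousLinearEquiv : _ →L[ℝ] HomSobolev d s))
  let F' : StrongDual ℂ (Lp ℂ 2 (volume : Measure (Eucl d))) := F.extendRCLike
  refine ⟨(InnerProductSpace.toDual ℂ _).symm F', fun u => ?_⟩
  rw [InnerProductSpace.toDual_symm_apply]
  have h1 : (F' (weightL2 d s u)).re = F (weightL2 d s u) := by
    simp [F', StrongDual.extendRCLike_apply]
  rw [h1]
  have h2 := hF ⟨weightL2 d s u, u, rfl⟩
  rw [h2]
  have h3 : e u = ⟨weightL2 d s u, u, rfl⟩ := rfl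
  rw [← h3]
  simp

/-- A sequence that is bounded in `H̊ˢ(ℝᵈ)` and converges as a sequence of tempered distributions
converges weakly. -/
theorem tendsto_dual_of_bounded (Λ : HomSobolevDual d s) {w : ℕ → HomSobolev d s}
    {u : HomSobolev d s} {C : ℝ} (hw : ∀ n, ‖w n‖ ≤ C)
    (h : ∀ φ : 𝓢(Eucl d, ℂ),
      Tendsto (fun n => ∫ x, (w n x : ℂ) * φ x) atTop (𝓝 (∫ x, (u x : ℂ) * φ x))) :
    Tendsto (fun n => Λ (w n)) atTop (𝓝 (Λ u)) := by
  obtain ⟨z, hz⟩ := exists_dual_eq_re_inner Λ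
  have hb (n : ℕ) : ‖weightL2 d s (w n - u)‖ ≤ C + ‖u‖ := by
    rw [LinearIsometry.norm_map]
    exact (norm_sub_le _ _).trans (by gcongr; exact hw n)
  have key := tendsto_inner_zero_of_total hb
    (D := {v | ∃ (φ : Eucl d → ℝ) (hφ : ContDiff ℝ ∞ φ) (hc : HasCompactSupport φ),
      tsupport φ ⊆ {0}ᶜ ∧ v = ((complexSchwartz hφ hc).memLp 2 volume).toLp}) ?_ ?_ z
  · rw [← tendsto_sub_nhds_zero_iff]
    have hre := (Complex.continuous_re.tendsto _).comp key
    refine hre.congr fun n => ?_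
    rw [← map_sub, hz]
    rfl
  · intro v hv
    have hnt := nontrivial_eucl (d := d) s
    rw [Lp.eq_zero_iff_ae_eq_zero]
    have hl : LocallyIntegrable v (volume : Measure (Eucl d)) :=
      (Lp.memLp v).locallyIntegrable (by norm_num)
    have h1 := (isOpen_compl_singleton (x := (0 : Eucl d))).ae_eq_zero_of_integral_contDiff_smul_eq_zero
      (hl.locallyIntegrableOn _) (fun φ hφ hc h0 => ?_)
    · filter_upwards [h1, compl_mem_ae_iff.2 (measure_singleton (0 : Eucl d))] with ξ hξ hξ0
      exact hξ hξ0
    · rw [← hv _ ⟨φ, hφ, hc, h0, rfl⟩, L2.inner_def]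
      refine integral_congr_ae ?_
      filter_upwards [((complexSchwartz hφ hc).memLp 2 volume).coeFn_toLp] with ξ h1
      rw [h1]
      simp [complexSchwartz_apply, mul_comm]
  · rintro _ ⟨φ, hφ, hc, h0, rfl⟩
    simp only [map_sub, inner_sub_right, inner_weightL2 hφ hc h0]
    rw [tendsto_sub_nhds_zero_iff]
    exact h _

end HomSobolev

section Mollifier

variable {d : ℕ}

/-- A bump function supported in the ball of radius `1 / (n + 1)`. -/
noncomputable def mollifierBump (d n : ℕ) : ContDiffBump (0 : Eucl d) :=
  ⟨1 / (2 * (n + 1)), 1 / (n + 1), by positivity, by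
    apply one_div_lt_one_div_of_lt <;> linarith⟩

theorem mollifierBump_rOut (d n : ℕ) : (mollifierBump d n).rOut = 1 / ((n : ℝ) + 1) := rfl

theorem mollifierBump_rOut_le_one (d n : ℕ) : (mollifierBump d n).rOut ≤ 1 := by
  rw [mollifierBump_rOut, div_le_one (by positivity)]
  linarith [(Nat.cast_nonneg n : (0 : ℝ) ≤ n)]

/-- The convolution of `f` with a smooth probability density on the ball of radius `1 / (n + 1)`. -/
noncomputable def mollify (f : Eucl d → ℝ) (n : ℕ) : Eucl d → ℝ :=
  (mollifierBump d n).normed volume ⋆[ContinuousLinearMap.lsmul ℝ ℝ, volume] f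

theorem contDiff_mollify {f : Eucl d → ℝ} (hf : LocallyIntegrable f volume) (n : ℕ) :
    ContDiff ℝ ∞ (mollify f n) :=
  (mollifierBump d n).hasCompactSupport_normed.contDiff_convolution_left _
    (mollifierBump d n).contDiff_normed hf

theorem mollify_add {f g : Eucl d → ℝ} (hf : LocallyIntegrable f volume)
    (hg : LocallyIntegrable g volume) (n : ℕ) :
    mollify (f + g) n = mollify f n + mollify g n :=
  ConvolutionExists.distrib_add
    ((mollifierBump d n).hasCompactSupport_normed.convolutionExists_left _
      (mollifierBump d n).continuous_normed hf)
    ((mollifierBump d n).hasCompactSupport_normed.convolutionExists_left _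
      (mollifierBump d n).continuous_normed hg)

theorem mollify_eq_of_notMem_cthickening {f : Eucl d → ℝ} {K : Set (Eucl d)}
    (hf : ∀ x, x ∉ K → f x = 0) (n : ℕ) {x : Eucl d} (hx : x ∉ Metric.cthickening 1 K) :
    mollify f n x = 0 ∧ f x = 0 := by
  have h0 (y : Eucl d) (hy : y ∈ Metric.ball x (mollifierBump d n).rOut) : f y = 0 := by
    refine hf y fun hyK => hx ?_
    refine Metric.mem_cthickening_of_dist_le x y 1 K hyK ?_
    rw [dist_comm]
    exact (Metric.mem_ball.1 hy).le.trans (mollifierBump_rOut_le_one d n)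
  have hx0 : f x = 0 := h0 x (Metric.mem_ball_self (mollifierBump d n).rOut_pos)
  refine ⟨?_, hx0⟩
  rw [mollify, (mollifierBump d n).normed_convolution_eq_right fun y hy => (h0 y hy).trans hx0.symm,
    hx0]

theorem lintegral_enorm_normed (n : ℕ) :
    ∫⁻ x, ‖(mollifierBump d n).normed volume x‖ₑ = 1 := by
  have h := (mollifierBump d n).integral_normed (μ := volume)
  rw [integral_eq_lintegral_of_nonneg_ae
    (Eventually.of_forall fun x => (mollifierBump d n).nonneg_normed x)
    (mollifierBump d n).continuous_normed.aestronglyMeasurable] at h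
  have e (x : Eucl d) : ‖(mollifierBump d n).normed volume x‖ₑ
      = ENNReal.ofReal ((mollifierBump d n).normed volume x) :=
    Real.enorm_of_nonneg ((mollifierBump d n).nonneg_normed x)
  simp only [e]
  rwa [ENNReal.toReal_eq_one_iff] at h

theorem eLpNorm_mollify_le {P Q : ℝ} (hPQ : P.HolderConjugate Q) {f : Eucl d → ℝ}
    (hf : AEStronglyMeasurable f volume) (n : ℕ) :
    eLpNorm (mollify f n) (ENNReal.ofReal P) volume ≤ eLpNorm f (ENNReal.ofReal P) volume := by
  have hP : ENNReal.ofReal P ≠ 0 := by simpa using hPQ.pos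
  rw [eLpNorm_eq_lintegral_rpow_enorm_toReal hP ENNReal.ofReal_ne_top,
    eLpNorm_eq_lintegral_rpow_enorm_toReal hP ENNReal.ofReal_ne_top,
    ENNReal.toReal_ofReal hPQ.nonneg]
  refine ENNReal.rpow_le_rpow ?_ (by simpa using hPQ.nonneg)
  have h := lintegral_convolution_rpow_le hPQ
    (k := fun x => ‖(mollifierBump d n).normed volume x‖ₑ) (f := fun x => ‖f x‖ₑ)
    (mollifierBump d n).continuous_normed.measurable.enorm hf.enorm
  rw [lintegral_enorm_normed, ENNReal.one_rpow, one_mul] at h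
  refine le_trans (lintegral_mono fun x => ?_) h
  refine ENNReal.rpow_le_rpow ?_ hPQ.nonneg
  rw [mollify, convolution_lsmul_swap]
  refine (enorm_integral_le_lintegral_enorm _).trans_eq ?_
  simp only [smul_eq_mul, enorm_mul]

theorem tendsto_eLpNorm_mollify_sub_of_continuous (p : ℝ≥0∞) (hp : p ≠ 0) (hp' : p ≠ ⊤)
    {w : Eucl d → ℝ} (hw : Continuous w) (hc : HasCompactSupport w) :
    Tendsto (fun n => eLpNorm (mollify w n - w) p volume) atTop (𝓝 0) := by
  set K := Metric.cthickening 1 (tsupport w) with hK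
  have hKc : IsCompact K := hc.isCompact.cthickening
  have hKm : MeasurableSet K := hKc.measurableSet
  have hvol : volume K ^ (1 / p.toReal) ≠ ⊤ :=
    (ENNReal.rpow_lt_top_of_nonneg (by positivity) hKc.measure_lt_top.ne).ne
  have huc : UniformContinuous w := hc.uniformContinuous_of_continuous hw
  have hbound {ε : ℝ} (hε : 0 < ε) :
      ∀ᶠ n in atTop, eLpNorm (mollify w n - w) p volume
        ≤ ENNReal.ofReal ε * volume K ^ (1 / p.toReal) := by
    obtain ⟨δ, hδ, hwδ⟩ := Metric.uniformContinuous_iff.1 huc ε hε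
    obtain ⟨N, hN⟩ := exists_nat_one_div_lt hδ
    filter_upwards [eventually_ge_atTop N] with n hn
    have hr : (mollifierBump d n).rOut ≤ δ := by
      rw [mollifierBump_rOut]
      refine le_trans ?_ hN.le
      gcongr
    calc eLpNorm (mollify w n - w) p volume
        ≤ eLpNorm (K.indicator fun _ => ε) p volume := by
          refine eLpNorm_mono fun x => ?_
          by_cases hx : x ∈ K
          · rw [Set.indicator_of_mem hx, Real.norm_of_nonneg hε.le, Pi.sub_apply, ← dist_eq_norm]
            refine (mollifierBump d n).dist_normed_convolution_le hw.aestronglyMeasurable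
              fun y hy => ?_
            exact (hwδ ((Metric.mem_ball.1 hy).trans_le hr)).le
          · obtain ⟨h1, h2⟩ := mollify_eq_of_notMem_cthickening
              (fun x hx => image_eq_zero_of_notMem_tsupport hx) n hx
            simp [h1, h2]
      _ = _ := by
          rw [eLpNorm_indicator_const hKm hp hp', Real.enorm_of_nonneg hε.le]
  rw [ENNReal.tendsto_nhds_zero]
  intro ε hε
  obtain ⟨η, hη, hη'⟩ : ∃ η : ℝ, 0 < η ∧ ENNReal.ofReal η * volume K ^ (1 / p.toReal) ≤ ε := by
    have ht : Tendsto (fun η : ℝ => ENNReal.ofReal η * volume K ^ (1 / p.toReal)) (𝓝[>] 0)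
        (𝓝 0) := by
      have := ENNReal.Tendsto.mul_const (b := volume K ^ (1 / p.toReal))
        ((ENNReal.continuous_ofReal.tendsto 0).mono_left (nhdsWithin_le_nhds (s := Set.Ioi 0)))
        (Or.inr hvol)
      simpa using this
    obtain ⟨η, h1, h2⟩ := ((ENNReal.tendsto_nhds_zero.1 ht ε hε).and self_mem_nhdsWithin).exists
    exact ⟨η, h2, h1⟩
  exact (hbound hη).mono fun n hn => hn.trans hη'

theorem tendsto_eLpNorm_mollify_sub {P Q : ℝ} (hPQ : P.HolderConjugate Q) {f : Eucl d → ℝ}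
    (hf : MemLp f (ENNReal.ofReal P) volume) :
    Tendsto (fun n => eLpNorm (mollify f n - f) (ENNReal.ofReal P) volume) atTop (𝓝 0) := by
  have h1P : 1 ≤ ENNReal.ofReal P := ENNReal.one_le_ofReal.2 hPQ.lt.le
  rw [ENNReal.tendsto_nhds_zero]
  intro ε hε
  have hε3 : ε / 3 ≠ 0 := (ENNReal.div_pos hε.ne' (by simp)).ne'
  obtain ⟨w, hwc, hfw, hw, hwL⟩ :=
    hf.exists_hasCompactSupport_eLpNorm_sub_le ENNReal.ofReal_ne_top hε3
  have hl : LocallyIntegrable (f - w) volume := (hf.sub hwL).locallyIntegrable h1P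
  have hwt := tendsto_eLpNorm_mollify_sub_of_continuous (ENNReal.ofReal P)
    (zero_lt_one.trans_le h1P).ne' ENNReal.ofReal_ne_top hw hwc
  filter_upwards [ENNReal.tendsto_nhds_zero.1 hwt (ε / 3) (pos_iff_ne_zero.2 hε3)] with n hn
  have e : mollify f n - f = mollify (f - w) n + (mollify w n - w) + (w - f) := by
    have : mollify f n = mollify (f - w) n + mollify w n := by
      rw [← mollify_add hl hw.locallyIntegrable, sub_add_cancel]
    rw [this]
    abel
  have m1 : AEStronglyMeasurable (mollify (f - w) n) volume :=
    (contDiff_mollify hl n).continuous.aestronglyMeasurable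
  have m2 : AEStronglyMeasurable (mollify w n - w) volume :=
    ((contDiff_mollify hw.locallyIntegrable n).continuous.sub hw).aestronglyMeasurable
  rw [e]
  refine (eLpNorm_add_le (m1.add m2) (hwL.1.sub hf.1) h1P).trans ?_
  refine (add_le_add_left (eLpNorm_add_le m1 m2 h1P) _).trans ?_
  rw [eLpNorm_sub_comm w f]
  calc _ ≤ ε / 3 + ε / 3 + ε / 3 := by
        gcongr
        exact (eLpNorm_mollify_le hPQ (hf.1.sub hwL.1) n).trans hfw
    _ = ε := ENNReal.add_thirds ε

theorem norm_fourier_normed_le_one (n : ℕ) (ξ : Eucl d) :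
    ‖𝓕 (fun x => (((mollifierBump d n).normed volume x : ℝ) : ℂ)) ξ‖ ≤ 1 := by
  refine (VectorFourier.norm_fourierIntegral_le_integral_norm _ _ _ _ _).trans_eq ?_
  simp only [Complex.norm_real, Real.norm_eq_abs, abs_of_nonneg ((mollifierBump d n).nonneg_normed _)]
  exact (mollifierBump d n).integral_normed

theorem norm_fourier_mollify_le {f : Eucl d → ℝ} (hf : Integrable f) (n : ℕ) (ξ : Eucl d) :
    ‖𝓕 (fun x => (mollify f n x : ℂ)) ξ‖ ≤ ‖𝓕 (fun x => (f x : ℂ)) ξ‖ := by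
  have e : (fun x => (mollify f n x : ℂ))
      = (fun x => (((mollifierBump d n).normed volume x : ℝ) : ℂ))
        ⋆[ContinuousLinearMap.mul ℂ ℂ, volume] fun x => (f x : ℂ) := by
    ext x
    rw [mollify, convolution_def, convolution_def, ← integral_complex_ofReal]
    simp
  have h := Real.fourier_mul_convolution_eq
    ((mollifierBump d n).integrable_normed (μ := volume)).ofReal hf.ofReal ξ (R := ℂ)
  rw [e]
  refine (congrArg norm h).trans_le ?_
  rw [norm_mul]
  exact mul_le_of_le_one_left (norm_nonneg _) (norm_fourier_normed_le_one n ξ)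

end Mollifier

theorem tendsto_integral_smul_of_tendsto_eLpNorm {α F : Type*} [MeasurableSpace α]
    {μ : Measure α} [NormedAddCommGroup F] [NormedSpace ℝ F] {p q : ℝ≥0∞}
    [ENNReal.HolderConjugate p q] {v : ℕ → α → ℝ} {v₀ : α → ℝ} {τ : α → F}
    (hv : ∀ n, MemLp (v n) p μ) (hv₀ : MemLp v₀ p μ) (hτ : MemLp τ q μ)
    (h : Tendsto (fun n => eLpNorm (v n - v₀) p μ) atTop (𝓝 0)) :
    Tendsto (fun n => ∫ x, v n x • τ x ∂μ) atTop (𝓝 (∫ x, v₀ x • τ x ∂μ)) := by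
  have hi {w : α → ℝ} (hw : MemLp w p μ) : Integrable (w • τ) μ :=
    memLp_one_iff_integrable.1 (hτ.smul hw)
  refine tendsto_integral_of_L1' (fun x => v₀ x • τ x) (hi hv₀).1
    (Eventually.of_forall fun n => hi (hv n)) ?_
  have hlim : Tendsto (fun n => eLpNorm (v n - v₀) p μ * eLpNorm τ q μ) atTop (𝓝 0) := by
    simpa using ENNReal.Tendsto.mul_const h (Or.inr hτ.2.ne)
  refine tendsto_of_tendsto_of_tendsto_of_le_of_le tendsto_const_nhds hlim (fun _ => zero_le)
    fun n => ?_
  refine le_of_eq_of_le ?_ (eLpNorm_smul_le_mul_eLpNorm (r := 1) hτ.1 ((hv n).sub hv₀).1)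
  congr 1
  ext x
  simp [sub_smul]

namespace HomSobolev

variable {d : ℕ} {s : ℝ} [hs : Fact (0 < s ∧ s < (d : ℝ) / 2)]

variable (d s) in
theorem holderConjugate_sobolevExponent :
    (2 * d / (d - 2 * s)).HolderConjugate (2 * d / (d + 2 * s)) := by
  obtain ⟨h1, h2⟩ := hs.out
  have hd : (0 : ℝ) < d := by linarith
  have hd' : 0 < d - 2 * s := by linarith
  rw [Real.holderConjugate_iff]
  refine ⟨?_, ?_⟩
  · rw [lt_div_iff₀ hd']
    linarith
  · field_simp
    ring

/-- If `T ∈ H̊⁻ˢ ∩ L^q_loc`, the pairing with compactly supported elements of `H̊ˢ` is given by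
integration. -/
theorem dual_eq_integral_of_compact {q : ℝ≥0∞}
    (hq : ENNReal.ofReal (2 * d / (d + 2 * s)) ≤ q) {T : Eucl d → ℝ} (hT : MemLpLocally T q)
    {Λ : HomSobolevDual d s} (hΛ : Λ.IsRegular T) (v : HomSobolev d s) {K : Set (Eucl d)}
    (hK : IsCompact K) (hv : ∀ᵐ x, x ∉ K → v x = 0) :
    Integrable (fun x => T x * v x) volume ∧ Λ v = ∫ x, T x * v x := by
  have hPQ := holderConjugate_sobolevExponent d s
  have : ENNReal.HolderConjugate (sobolevExponent d s) (ENNReal.ofReal (2 * d / (d + 2 * s))) :=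
    hPQ.ennrealOfReal
  have h1P := one_le_sobolevExponent d s hs.out
  set v₀ := K.indicator v with hv₀
  have hvv₀ : v =ᵐ[volume] v₀ := by
    filter_upwards [hv] with x hx
    by_cases h : x ∈ K
    · simp [hv₀, h]
    · simp [hv₀, h, hx h]
  have hv₀L : MemLp v₀ (sobolevExponent d s) volume := v.memLp.indicator hK.measurableSet
  have hv₀l : LocallyIntegrable v₀ volume := hv₀L.locallyIntegrable h1P
  have hv₀K (x : Eucl d) (hx : x ∉ K) : v₀ x = 0 := Set.indicator_of_notMem hx _
  have hv₀i : Integrable v₀ volume :=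
    (hv₀l.integrableOn_isCompact hK).integrable_of_forall_notMem_eq_zero hv₀K
  set K' := Metric.cthickening 1 K with hK'
  have hK'c : IsCompact K' := hK.cthickening
  have hKK' : K ⊆ K' := Metric.self_subset_cthickening K
  have hsm (n : ℕ) : ContDiff ℝ ∞ (mollify v₀ n) := contDiff_mollify hv₀l n
  have hcs (n : ℕ) : HasCompactSupport (mollify v₀ n) :=
    HasCompactSupport.intro hK'c fun x hx => (mollify_eq_of_notMem_cthickening hv₀K n hx).1
  have hL (n : ℕ) : MemLp (mollify v₀ n) (sobolevExponent d s) volume :=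
    (hsm n).continuous.memLp_of_hasCompactSupport (hcs n)
  have hLp := tendsto_eLpNorm_mollify_sub hPQ hv₀L
  set τ := K'.indicator T with hτ
  have hτL : MemLp τ (ENNReal.ofReal (2 * d / (d + 2 * s))) volume := by
    rw [hτ, memLp_indicator_iff_restrict hK'c.measurableSet]
    have : IsFiniteMeasure (volume.restrict K') := ⟨by simpa using hK'c.measure_lt_top⟩
    exact (hT K' hK'c).mono_exponent hq
  have eτ {w : Eucl d → ℝ} (hw : ∀ x, x ∉ K' → w x = 0) (x : Eucl d) :
      w x • τ x = T x * w x := by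
    by_cases h : x ∈ K'
    · simp [hτ, h, mul_comm]
    · simp [hτ, h, hw x h]
  have eτ₀ : (fun x => v₀ x • τ x) = fun x => T x * v₀ x :=
    funext <| eτ fun x hx => hv₀K x fun h => hx (hKK' h)
  have hint : Integrable (fun x => T x * v₀ x) volume := by
    rw [← eτ₀]
    exact memLp_one_iff_integrable.1 (hτL.smul hv₀L)
  have hTv : (fun x => T x * v₀ x) =ᵐ[volume] fun x => T x * v x :=
    hvv₀.mono fun x hx => by simp only [hx]
  refine ⟨hint.congr hTv, ?_⟩
  let w : ℕ → HomSobolev d s := fun n => ofTestFunction (mollify v₀ n) (hsm n) (hcs n)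
  have hw (n : ℕ) : ⇑(w n) =ᵐ[volume] mollify v₀ n := coe_ofTestFunction _ _ _
  have hwΛ (n : ℕ) : Λ (w n) = ∫ x, mollify v₀ n x • τ x := by
    rw [hΛ (mollify v₀ n) (hsm n) (hcs n)]
    refine integral_congr_ae (Eventually.of_forall fun x => ?_)
    exact (eτ (fun x hx => (mollify_eq_of_notMem_cthickening hv₀K n hx).1) x).symm
  have lim1 : Tendsto (fun n => Λ (w n)) atTop (𝓝 (∫ x, T x * v x)) := by
    have h := tendsto_integral_smul_of_tendsto_eLpNorm hL hv₀L hτL hLp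
    simp only [← hwΛ] at h
    rwa [eτ₀, integral_congr_ae hTv] at h
  have hbd (n : ℕ) : ‖w n‖ ≤ ‖v‖ := by
    have hFT := (IsFourierTransformOf.of_integrable hv₀i).congr_ae hvv₀.symm
    have hFTn := (IsFourierTransformOf.of_integrable
      ((hsm n).continuous.integrable_of_hasCompactSupport (hcs n))).congr_ae (hw n).symm
    have h : ENNReal.ofReal (‖w n‖ ^ 2) ≤ ENNReal.ofReal (‖v‖ ^ 2) := by
      rw [ofReal_sq_norm_eq hFT, ofReal_sq_norm_eq hFTn]
      refine lintegral_mono fun ξ => ?_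
      gcongr
      rw [enorm_le_iff_norm_le]
      exact norm_fourier_mollify_le hv₀i n ξ
    rw [ENNReal.ofReal_le_ofReal_iff (by positivity)] at h
    exact (sq_le_sq₀ (norm_nonneg _) (norm_nonneg _)).1 h
  have lim2 : Tendsto (fun n => Λ (w n)) atTop (𝓝 (Λ v)) := by
    refine tendsto_dual_of_bounded Λ hbd fun φ => ?_
    have h := tendsto_integral_smul_of_tendsto_eLpNorm hL hv₀L
      (φ.memLp (ENNReal.ofReal (2 * d / (d + 2 * s))) volume) hLp
    have e1 : ∫ x, (v x : ℂ) * φ x = ∫ x, v₀ x • φ x :=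
      integral_congr_ae (hvv₀.mono fun x hx => by simp [hx])
    have e2 (n : ℕ) : ∫ x, (w n x : ℂ) * φ x = ∫ x, mollify v₀ n x • φ x :=
      integral_congr_ae ((hw n).mono fun x hx => by simp [hx])
    simpa only [e1, e2] using h
  exact tendsto_nhds_unique lim2 lim1

end HomSobolev

/-- A smooth cutoff function that is `1` on the unit ball. -/
noncomputable def cutoff (d : ℕ) : ContDiffBump (0 : Eucl d) := ⟨1, 2, one_pos, one_lt_two⟩

theorem eventually_cutoff_eq_one {d : ℕ} (x : Eucl d) :
    ∀ᶠ n : ℕ in atTop, cutoff d (((n : ℝ) + 1)⁻¹ • x) = 1 := by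
  obtain ⟨N, hN⟩ := exists_nat_ge ‖x‖
  filter_upwards [eventually_ge_atTop N] with n hn
  refine (cutoff d).one_of_mem_closedBall ?_
  have h : (N : ℝ) ≤ n := by exact_mod_cast hn
  rw [mem_closedBall_zero_iff, norm_smul, Real.norm_of_nonneg (by positivity), inv_mul_le_iff₀
    (by positivity)]
  change ‖x‖ ≤ (n + 1) * 1
  linarith

/-- Products with cutoff functions of an integrable function converge in mean. -/
theorem tendsto_integral_cutoff_mul {d : ℕ} {F : Type*} [NormedAddCommGroup F] [NormedSpace ℝ F]
    {f : Eucl d → F} (hf : Integrable f) :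
    Tendsto (fun n : ℕ => ∫ x, cutoff d (((n : ℝ) + 1)⁻¹ • x) • f x) atTop (𝓝 (∫ x, f x)) := by
  refine tendsto_integral_of_dominated_convergence (fun x => ‖f x‖) (fun n => ?_) hf.norm
    (fun n => Eventually.of_forall fun x => ?_) (Eventually.of_forall fun x => ?_)
  · exact ((cutoff d).continuous.comp (continuous_const_smul _)).aestronglyMeasurable.smul hf.1
  · rw [norm_smul, Real.norm_of_nonneg (cutoff d).nonneg]
    exact mul_le_of_le_one_left (norm_nonneg _) (cutoff d).le_one
  · refine tendsto_const_nhds.congr' ?_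
    filter_upwards [eventually_cutoff_eq_one x] with n hn
    rw [hn, one_smul]

/-- A function bounded below by an integrable function is integrable if the integrals of its
products with the cutoff functions are bounded. -/
theorem integrable_of_bounded_integral_cutoff_mul {d : ℕ} {g f : Eucl d → ℝ}
    (hg : AEStronglyMeasurable g volume) (hf : Integrable f) (hgf : ∀ᵐ x, g x ≥ -|f x|)
    (hi : ∀ n : ℕ, Integrable fun x => cutoff d (((n : ℝ) + 1)⁻¹ • x) * g x) {C : ℝ}
    (hC : ∀ n : ℕ, ∫ x, cutoff d (((n : ℝ) + 1)⁻¹ • x) * g x ≤ C) : Integrable g := by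
  have hfi (n : ℕ) : Integrable fun x => cutoff d (((n : ℝ) + 1)⁻¹ • x) * |f x| := by
    refine hf.abs.bdd_mul (c := 1)
      ((cutoff d).continuous.comp (continuous_const_smul _)).aestronglyMeasurable
      (Eventually.of_forall fun x => ?_)
    rw [Real.norm_of_nonneg (cutoff d).nonneg]
    exact (cutoff d).le_one
  set h : Eucl d → ℝ := fun x => g x + |f x| with hh
  have h0 : 0 ≤ᵐ[volume] h := hgf.mono fun x hx => by simp only [hh, Pi.zero_apply]; linarith
  have hm : AEStronglyMeasurable h volume := hg.add hf.abs.1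
  suffices hint : Integrable h from (hint.sub hf.abs).congr (Eventually.of_forall fun x => by
    simp [hh])
  set H : ℕ → Eucl d → ℝ≥0∞ := fun n x => ENNReal.ofReal (cutoff d (((n : ℝ) + 1)⁻¹ • x) * h x)
    with hH
  have hHle (n : ℕ) : ∫⁻ x, H n x ≤ ENNReal.ofReal (C + ∫ x, |f x|) := by
    have e : (fun x => cutoff d (((n : ℝ) + 1)⁻¹ • x) * h x) = fun x =>
        cutoff d (((n : ℝ) + 1)⁻¹ • x) * g x + cutoff d (((n : ℝ) + 1)⁻¹ • x) * |f x| := by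
      ext x
      simp only [hh]
      ring
    have hi' : Integrable fun x => cutoff d (((n : ℝ) + 1)⁻¹ • x) * h x := by
      rw [e]
      exact (hi n).add (hfi n)
    rw [← ofReal_integral_eq_lintegral_ofReal hi'
      (h0.mono fun x hx => mul_nonneg (cutoff d).nonneg hx), e, integral_add (hi n) (hfi n)]
    refine ENNReal.ofReal_le_ofReal (add_le_add (hC n) ?_)
    refine integral_mono (hfi n) hf.abs fun x => ?_
    exact mul_le_of_le_one_left (abs_nonneg _) (cutoff d).le_one
  have hHm (n : ℕ) : AEMeasurable (H n) volume := by
    refine AEMeasurable.ennreal_ofReal (AEMeasurable.mul ?_ hm.aemeasurable)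
    exact ((cutoff d).continuous.comp (continuous_const_smul _)).aemeasurable
  have hlim (x : Eucl d) : liminf (fun n => H n x) atTop = ENNReal.ofReal (h x) := by
    refine Tendsto.liminf_eq (tendsto_const_nhds.congr' ?_)
    filter_upwards [eventually_cutoff_eq_one x] with n hn
    simp only [hH, hn, one_mul]
  refine ⟨hm, ?_⟩
  rw [hasFiniteIntegral_iff_ofReal h0]
  calc ∫⁻ x, ENNReal.ofReal (h x) = ∫⁻ x, liminf (fun n => H n x) atTop := by simp only [hlim]
    _ ≤ liminf (fun n => ∫⁻ x, H n x) atTop := lintegral_liminf_le' hHm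
    _ ≤ ENNReal.ofReal (C + ∫ x, |f x|) := by
        refine liminf_le_of_le (by isBoundedDefault) fun b hb => ?_
        obtain ⟨n, hn⟩ := hb.exists
        exact hn.trans (hHle n)
    _ < ⊤ := ENNReal.ofReal_lt_top

theorem MemLpLocally.aestronglyMeasurable {d : ℕ} {T : Eucl d → ℝ} {q : ℝ≥0∞}
    (hT : MemLpLocally T q) : AEStronglyMeasurable T volume := by
  rw [← Measure.restrict_univ (μ := volume), ← iUnion_compactCovering,
    aestronglyMeasurable_iUnion_iff]
  exact fun n => (hT _ (isCompact_compactCovering _ n)).1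

theorem theorem4p3 (d : ℕ) (hd : 2 ≤ d) (s : ℝ) [hs : Fact (0 < s ∧ s < (d : ℝ) / 2)]
    (q : ℝ≥0∞) (hq : ENNReal.ofReal (2 * d / (d + 2 * s)) ≤ q)
    (T : Eucl d → ℝ) (hT : MemLpLocally T q)
    (Λ : HomSobolevDual d s) (hΛ : Λ.IsRegular T)
    (u : HomSobolev d s) (f : Eucl d → ℝ) (hf : Integrable f volume)
    (hTu : ∀ᵐ x, T x * u x ≥ -|f x|) :
    Integrable (fun x => T x * u x) volume ∧ Λ u = ∫ x, T x * u x := by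
  obtain ⟨C, hC⟩ := HomSobolev.exists_cutoff_mul (d := d) (s := s) (cutoff d).contDiff
    (cutoff d).hasCompactSupport
  choose w hw hwC using fun n : ℕ => hC u ((n : ℝ) + 1) (by positivity)
  have hcs (n : ℕ) : HasCompactSupport fun x => cutoff d (((n : ℝ) + 1)⁻¹ • x) :=
    (cutoff d).hasCompactSupport.comp_inv_smul (by positivity)
  have hwT (n : ℕ) := HomSobolev.dual_eq_integral_of_compact hq hT hΛ (w n) (hcs n).isCompact
    ((hw n).mono fun x hx hxK => by
      rw [hx]
      beta_reduce
      rw [image_eq_zero_of_notMem_tsupport (f := fun x => cutoff d (((n : ℝ) + 1)⁻¹ • x)) hxK,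
        zero_mul])
  have hwTu (n : ℕ) : (fun x => T x * w n x)
      =ᵐ[volume] fun x => cutoff d (((n : ℝ) + 1)⁻¹ • x) * (T x * u x) :=
    (hw n).mono fun x hx => by
      simp only [hx]
      ring
  have hbd (n : ℕ) : ‖w n‖ ≤ √(C * ‖u‖ ^ 2) := Real.le_sqrt_of_sq_le (hwC n)
  have lim : Tendsto (fun n => Λ (w n)) atTop (𝓝 (Λ u)) := by
    refine HomSobolev.tendsto_dual_of_bounded Λ hbd fun φ => ?_
    have h := tendsto_integral_cutoff_mul (IsFourierTransformOf.integrable_mul_schwartz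
      (one_le_sobolevExponent d s hs.out) u.memLp φ)
    refine h.congr fun n => integral_congr_ae ((hw n).mono fun x hx => ?_)
    simp only [hx, Complex.real_smul, Complex.ofReal_mul]
    ring
  have hΛw (n : ℕ) : Λ (w n) = ∫ x, cutoff d (((n : ℝ) + 1)⁻¹ • x) * (T x * u x) := by
    rw [(hwT n).2, integral_congr_ae (hwTu n)]
  have hint : Integrable fun x => T x * u x := by
    refine integrable_of_bounded_integral_cutoff_mul
      (hT.aestronglyMeasurable.mul u.memLp.1) hf hTu (fun n => (hwT n).1.congr (hwTu n))
      (C := ‖Λ‖ * √(C * ‖u‖ ^ 2)) fun n => ?_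
    rw [← hΛw]
    exact (le_abs_self _).trans ((Λ.le_opNorm _).trans (by gcongr; exact hbd n))
  refine ⟨hint, tendsto_nhds_unique lim ?_⟩
  simpa only [hΛw, smul_eq_mul] using tendsto_integral_cutoff_mul hint
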